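/- Let $n\ge 3$, and let $O_{2n}$ be a regular $2n$-gon with two horizontal sides, opposite sides being glued by translation. Label the pairs of opposite sides clockwise by $L_1,\dots,L_n$, with $L_1$ the pair of horizontal sides, and put $\mathscr A=\{L_1,\dots,L_n\}$. The cutting sequence of a bi-infinite linear trajectory (in any direction, never hitting a vertex) is the word in $\mathscr A^{\mathbb Z}$ formed by the labels of the sides successively crossed; $\mathscr A^{\mathbb Z}$ has the product topology. Words in $\mathscr A^{\mathbb Z}$ obtained below by deleting or inserting letters are considered up to shift. *Diagrams.* Let $\alpha$, $\beta$ be the reflections in the horizontal axis and in the line at angle $\pi/2n$ to it. For $0\le i\le 2n-1$ let $\nu_i=(\alpha\beta)^k$ if $i=2k$ and $\nu_i=(\beta\alpha)^k\beta$ if $i=2k+1$ (so $\nu_i$ maps the sector of directions $[\frac{\pi i}{2n},\frac{\pi(i+1)}{2n}]$ to $[0,\frac{\pi}{2n}]$), and let $\pi_i$ be the permutation of $\mathscr A$ induced by $\nu_i$. Let $\mathscr D_0$ be the directed graph on $\mathscr A$ with an edge $L_a\to L_b$ iff $a+b\in\{n+1,n+2\}$ (the path $L_1 - L_n - L_2 -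 L_{n-1}-\cdots$, edges in both directions, with a loop at its last vertex), and let $\mathscr D_i$ have an edge $L\to L'$ iff $\mathscr D_0$ has an edge $\pi_i(L)\to\pi_i(L')$. Let $\mathscr A_i$ be the set of words in $\mathscr A^{\mathbb Z}$ that describe infinite paths on $\mathscr D_i$ (admissible in diagram $i$); a word is admissible if it lies in some $\mathscr A_i$. *Derivation.* A letter of a word is $L'$-sandwiched if it is preceded and followed by $L'$, and sandwiched if it is $L'$-sandwiched for some $L'$. The derived word $w'$ is obtained by keeping only the sandwiched letters of $w$. A word $w$ is derivable if $w$ and $w'$ are admissible, and infinitely derivable if $w$ and all its iterated derived words are derivable. *Coherence.* Let $\pi^{\uparrow}(L_j)=L_{n+1-j}$ for all $j$, and $\pi^{\rightarrow}(L_1)=L_1$, $\pi^{\rightarrow}(L_j)=L_{n+2-j}$ for $j\ge2$. For $0\le l\le n-1$ put $\sigma_l(L_j)=\pi^{\uparrow}(L_j)$ if $1\le j\le n-l$ and $\sigma_l(L_j)=\pi^{\rightarrow}(L_j)$ if $n-l<j\le n$. A derivable word $w$ is coherent with respect to $(i,j)$, where $0\le i\le 2n-1$ and $1\le j\le 2n-1$,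 if $w\in\mathscr A_i$, every sandwiched letter $L$ of $\pi_i\cdot w$ is $\sigma_{\lfloor j/2\rfloor}(L)$-sandwiched, and $(\pi_i\cdot w)'\in\mathscr A_j$. A word $w$ is infinitely coherent if it is infinitely derivable and there is a sequence $(s_k)_{k\ge0}$ with $0\le s_0\le 2n-1$ and $1\le s_k\le 2n-1$ for $k\ge1$ such that for every $k\ge 0$ the word $w_k$, where $w_0=w$ and $w_{k+1}=(\pi_{s_k}\cdot w_k)'$, is coherent with respect to $(s_k,s_{k+1})$. *Generation.* For an edge $L\to L'$ of $\mathscr D_j$, $1\le j\le 2n-1$, the interpolating word $u=u^{j}_{LL'}$ is the finite, possibly empty, word such that $L\,u\,L'$ is a block of consecutive letters in the word $L_1L_nL_2L_{n-1}\cdots\cdots L_{n-1}L_2L_nL_1$ of length $2n$ (which runs through $\mathscr D_0$ from $L_1$ to the loop, once along the loop, and back to $L_1$), in which the first letter $L$ is followed by $\sigma_{\lfloor j/2\rfloor}(L)$ and the last letter $L'$ is preceded by $\sigma_{\lfloor j/2\rfloor}(L')$. For $v\in\mathscr A_j$ let $\mathfrak g_j^0 v$ be obtained by inserting between any two successive letters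 $L,L'$ of $v$ the word $u^{j}_{LL'}$, and put $\mathfrak g_j^i v=\pi_i^{-1}\cdot\mathfrak g_j^0v$. **Theorem.** The closure in $\mathscr A^{\mathbb Z}$ of the set of all cutting sequences for $O_{2n}$ is the set of infinitely coherent words. It is also equal to $$\bigcap_{k\in\mathbb N}\ \bigcup_{\substack{0\le s_0\le 2n-1\\ 1\le s_1,\dots,s_k\le 2n-1}}\left\{\mathfrak g_{s_1}^{s_0}\,\mathfrak g_{s_2}^{s_1}\cdots\mathfrak g_{s_k}^{s_{k-1}}u \;:\; u\in\mathscr A_{s_k}\right\}.$$ -/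

import Mathlib

namespace TwoNGon

/-! ### The regular `2n`-gon and its linear trajectories

The polygon is centred at the origin of `ℂ = ℝ²`, has inradius `1` and two horizontal sides.
The sides are numbered clockwise from the top side by `0, 1, ..., 2n - 1`; side `i` is opposite
to side `i + n`. The letter `L_j` (`1 ≤ j ≤ n`) is represented by `j - 1 : ZMod n`, so that
`L_1` (the horizontal sides) is `0`, and sides `i` and `i + n` carry the same letter. -/

/-- The outer unit normal of side `i`. -/
noncomputable def normal (n : ℕ) (i : Fin (2 * n)) : ℂ :=
  Complex.exp (((Real.pi / 2 - Real.pi * (i : ℕ) / n : ℝ) : ℂ) * Complex.I)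

/-- The scalar product of `z` with the outer normal of side `i`. -/
noncomputable def height (n : ℕ) (i : Fin (2 * n)) (z : ℂ) : ℝ :=
  (z * (starRingEnd ℂ) (normal n i)).re

/-- The interior of the polygon. -/
def interiorPolygon (n : ℕ) : Set ℂ :=
  {z | ∀ i, height n i z < 1}

/-- Side `i` without its two end points (the vertices). -/
def openSide (n : ℕ) (i : Fin (2 * n)) : Set ℂ :=
  {z | height n i z = 1 ∧ ∀ j, j ≠ i → height n j z < 1}

/-- The letter on side `i`. -/
def label (n : ℕ) (i : Fin (2 * n)) : ZMod n := ((i : ℕ) : ZMod n)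

/-- A bi-infinite linear trajectory in direction `θ` on the `2n`-gon with opposite sides glued by
translations. It crosses a side at each of the times `time k`, `k ∈ ℤ`. From time `time k` to time
`time (k + 1)` it moves inside the polygon with velocity `exp (iθ)` from the boundary point
`entry k`; at time `time (k + 1)` it reaches side `side k`, at a point which is not a vertex, and
re-enters at the corresponding point of the opposite side, which is the translate by minus twice
the normal. -/
structure LinearTrajectory (n : ℕ) where
  θ : ℝ
  time : ℤ → ℝ
  side : ℤ → Fin (2 * n)
  entry : ℤ → ℂ
  time_strictMono : StrictMono time
  time_atTop : Filter.Tendsto time Filter.atTop Filter.atTop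
  time_atBot : Filter.Tendsto time Filter.atBot Filter.atBot
  inside : ∀ k : ℤ, ∀ t ∈ Set.Ioo (time k) (time (k + 1)),
    entry k + ((t - time k : ℝ) : ℂ) * Complex.exp ((θ : ℂ) * Complex.I) ∈ interiorPolygon n
  hits : ∀ k : ℤ,
    entry k + ((time (k + 1) - time k : ℝ) : ℂ) * Complex.exp ((θ : ℂ) * Complex.I)
      ∈ openSide n (side k)
  reenters : ∀ k : ℤ,
    entry (k + 1) =
      entry k + ((time (k + 1) - time k : ℝ) : ℂ) * Complex.exp ((θ : ℂ) * Complex.I)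
        - 2 * normal n (side k)

/-- Bi-infinite words, with the product topology of the discrete topology on the alphabet. -/
abbrev Word (n : ℕ) : Type := ℤ → ZMod n

/-- The cutting sequence of a trajectory: the labels of the sides crossed, in order. -/
def cuttingSequence {n : ℕ} (τ : LinearTrajectory n) : Word n := fun k => label n (τ.side k)

/-- The set of all cutting sequences (of trajectories in all directions). -/
def cuttingSequences (n : ℕ) : Set (Word n) := Set.range (cuttingSequence (n := n))

/-! ### Permutations, transition diagrams, admissibility -/

/-- The permutation induced by the reflection in the horizontal axis. The reflection in the
vertical axis induces the same one: `L_1 ↦ L_1` and `L_j ↦ L_{n + 2 - j}` for `j ≥ 2`. -/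
def permHor (n : ℕ) : Equiv.Perm (ZMod n) := Equiv.neg (ZMod n)

/-- The permutation induced by the reflection in the line at angle `π / 2n` to the horizontal.
The reflection in the line at angle `π / 2n` to the vertical induces the same one:
`L_j ↦ L_{n + 1 - j}`. -/
def permSlant (n : ℕ) : Equiv.Perm (ZMod n) := (Equiv.neg (ZMod n)).trans (Equiv.subRight 1)

/-- The permutation `π_i` induced by the isometry which maps the sector
`[π i / 2n, π (i + 1) / 2n]` to `[0, π / 2n]`, namely `(αβ)^k` for `i = 2k` and `(βα)^k β` for
`i = 2k + 1`, where `α` and `β` are the two reflections above. -/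
def perm (n i : ℕ) : Equiv.Perm (ZMod n) :=
  if Even i then (permHor n * permSlant n) ^ (i / 2)
  else (permSlant n * permHor n) ^ (i / 2) * permSlant n

/-- The action of a permutation of the letters on words. -/
def relabel {n : ℕ} (p : Equiv.Perm (ZMod n)) (w : Word n) : Word n := fun m => p (w m)

/-- The edges of the transition diagram of the sector `[0, π / 2n]`: the path
`L_1 - L_n - L_2 - L_{n-1} - ⋯`, with edges in both directions and with a loop at its last vertex;
that is, `L_a → L_b` iff `a + b = n + 1` or `a + b = n + 2`. -/
def Edge0 (n : ℕ) (a b : ZMod n) : Prop := a.val + b.val + 1 = n ∨ a.val + b.val = n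

/-- The edges of the transition diagram of the sector `[π i / 2n, π (i + 1) / 2n]`. -/
def Edge (n i : ℕ) (a b : ZMod n) : Prop := Edge0 n (perm n i a) (perm n i b)

/-- The words which are admissible in diagram `i`. -/
def admissibleIn (n i : ℕ) : Set (Word n) := {w | ∀ m : ℤ, Edge n i (w m) (w (m + 1))}

/-- Admissible words. -/
def IsAdmissible (n : ℕ) (w : Word n) : Prop := ∃ i < 2 * n, w ∈ admissibleIn n i

/-! ### Derivation -/

/-- The letter of `w` at place `m` is `L`-sandwiched. -/
def SandwichedBy {n : ℕ} (w : Word n) (m : ℤ) (L : ZMod n) : Prop :=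
  w (m - 1) = L ∧ w (m + 1) = L

/-- The letter of `w` at place `m` is sandwiched. -/
def Sandwiched {n : ℕ} (w : Word n) (m : ℤ) : Prop := ∃ L, SandwichedBy w m L

/-- `v` is the derived sequence `w'` of `w`: it is obtained by keeping only the sandwiched letters
of `w`, in their order. The numbering of the letters of the derived sequence (its origin) is
immaterial, so `v` is determined by `w` up to a shift. -/
def IsDerived {n : ℕ} (w v : Word n) : Prop :=
  ∃ f : ℤ → ℤ, StrictMono f ∧ Set.range f = {m | Sandwiched w m} ∧ ∀ m, v m = w (f m)

/-- `w` is derivable: `w` and its derived sequence are admissible. -/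
def IsDerivable (n : ℕ) (w : Word n) : Prop :=
  IsAdmissible n w ∧ ∃ v, IsDerived w v ∧ IsAdmissible n v

/-- `w` is infinitely derivable: all iterated derived sequences are derivable. -/
def IsInfinitelyDerivable (n : ℕ) (w : Word n) : Prop :=
  ∃ V : ℕ → Word n, V 0 = w ∧ (∀ k, IsDerived (V k) (V (k + 1))) ∧ ∀ k, IsDerivable n (V k)

/-! ### Coherence -/

/-- The letter by which `L_j` is sandwiched in the group `G_l`: the image of `L_j` under
`permSlant` if `1 ≤ j ≤ n - l`, and under `permHor` if `n - l < j ≤ n`. -/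
def groupLetter (n l : ℕ) (a : ZMod n) : ZMod n :=
  if a.val + 1 + l ≤ n then permSlant n a else permHor n a

/-- All sandwiched letters which occur in `w` fall into the group `G_l`. -/
def InGroup (n l : ℕ) (w : Word n) : Prop :=
  ∀ m L, SandwichedBy w m L → L = groupLetter n l (w m)

/-- `w` is coherent with respect to the pair `(i, j)`. -/
def IsCoherentWith (n i j : ℕ) (w : Word n) : Prop :=
  IsDerivable n w ∧ i < 2 * n ∧ w ∈ admissibleIn n i ∧
    ∃ l < n, InGroup n l (relabel (perm n i) w) ∧
      (1 ≤ j ∧ j < 2 * n ∧ ∃ v, IsDerived (relabel (perm n i) w) v ∧ v ∈ admissibleIn n j) ∧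
      l = j / 2

/-- The sequences with `0 ≤ s_0 ≤ 2n - 1` and `1 ≤ s_k ≤ 2n - 1` for `k ≥ 1`. -/
def SStar (n : ℕ) : Set (ℕ → ℕ) := {s | ∀ k, s k < 2 * n ∧ (s k = 0 → k = 0)}

/-- `w` is infinitely coherent with respect to `s`: it is infinitely derivable and each of the
renormalized words `w_0 = w`, `w_{k+1} = (π_{s_k} w_k)'` is coherent with respect to
`(s_k, s_{k+1})`. -/
def IsInfinitelyCoherentWith (n : ℕ) (s : ℕ → ℕ) (w : Word n) : Prop :=
  IsInfinitelyDerivable n w ∧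
    ∃ W : ℕ → Word n, W 0 = w ∧
      (∀ k, IsDerived (relabel (perm n (s k)) (W k)) (W (k + 1))) ∧
      ∀ k, IsCoherentWith n (s k) (s (k + 1)) (W k)

/-- The set of infinitely coherent words. -/
def infinitelyCoherent (n : ℕ) : Set (Word n) :=
  {w | ∃ s ∈ SStar n, IsInfinitelyCoherentWith n s w}

/-! ### Generation operators -/

/-- The word `L_1 L_n L_2 L_{n-1} ⋯ ⋯ L_2 L_n L_1` of length `2n` (its places are `0, ..., 2n - 1`),
which runs through the transition diagram of the sector `[0, π / 2n]` from `L_1` to the loop,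
along the loop, and back to `L_1`. -/
def snake (n t : ℕ) : ZMod n :=
  if Even t then ((t / 2 : ℕ) : ZMod n) else -(((t + 1) / 2 : ℕ) : ZMod n)

/-- The table of possible interpolations of the transition `a b`: the words `u` such that `a u b`
is a path in the transition diagram of `[0, π / 2n]` with no sandwiched letter in its inside,
i.e. the words `u` for which `a u b` occurs in `L_1 L_n L_2 L_{n-1} ⋯ ⋯ L_2 L_n L_1`. -/
def interpolationTable (n : ℕ) (a b : ZMod n) : Set (List (ZMod n)) :=
  {u | ∃ t t' : ℕ, t < t' ∧ t' < 2 * n ∧ snake n t = a ∧ snake n t' = b ∧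
    u = (List.range' (t + 1) (t' - t - 1)).map (snake n)}

/-- `u` is the interpolating word on the edge from `a` to `b` of diagram `k`: the entry of the table
in which `a` is followed, and `b` is preceded, by the letter by which it has to be sandwiched
according to the group `G_{[k/2]}`. -/
def IsInterpolatingWord (n k : ℕ) (a b : ZMod n) (u : List (ZMod n)) : Prop :=
  u ∈ interpolationTable n a b ∧
    (u ++ [b]).head? = some (groupLetter n (k / 2) a) ∧
    (a :: u).getLast? = some (groupLetter n (k / 2) b)

/-- `W` is the word generated from `v` by inserting, between any two successive letters of `v`,
the interpolating word of diagram `k`; the letter `v m` is moved to place `f m`. As for derivation,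
`W` is determined up to a shift. -/
def IsGenerated0 (n k : ℕ) (v W : Word n) : Prop :=
  ∃ f : ℤ → ℤ, (∀ m, W (f m) = v m) ∧
    ∀ m, ∃ u, IsInterpolatingWord n k (v m) (v (m + 1)) u ∧
      f (m + 1) = f m + u.length + 1 ∧
      ∀ (r : ℕ) (hr : r < u.length), W (f m + 1 + r) = u[r]

/-- The generation operator from diagram `j` to diagram `i`, applied to a set of words: the
words `π_i⁻¹ W` where `W` is generated from a word `v ∈ S` admissible in diagram `j`. -/
def generate (n j i : ℕ) (S : Set (Word n)) : Set (Word n) :=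
  {w | ∃ v ∈ S, v ∈ admissibleIn n j ∧
    ∃ W, IsGenerated0 n j v W ∧ w = relabel (perm n i)⁻¹ W}

/-- The set of words obtained by applying successively the generation operators from `s_k` to
`s_{k-1}`, ..., from `s_1` to `s_0` to the words admissible in diagram `s_k`. -/
def generatedSet (n : ℕ) : ℕ → (ℕ → ℕ) → Set (Word n)
  | 0, s => admissibleIn n (s 0)
  | k + 1, s => generate n (s 1) (s 0) (generatedSet n k fun m => s (m + 1))

end TwoNGon

namespace TwoNGon

/-! ### The dihedral action on letters -/

section Letters

variable {n : ℕ}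

/-! Follow a trajectory through its coordinate transversal to the direction. Crossing side `a` means
that this coordinate lies between the coordinates `X (a + 1)` and `X a` of the two ends of the side,
and the gluing subtracts their sum, twice the coordinate of the midpoint. Hence cutting sequences
are exactly the itineraries of an interval exchange (`IsCoded`, `cuttingSequences_eq`), and the
dihedral symmetry reduces every sector to `[0, π / 2n]` (`mem_sectorWords_iff`).

In that sector every directed edge of the diagram has exactly one place on the snake. A word is
therefore a path that advances along the snake and, at each sandwiched letter, jumps to the other
place of that letter, from `t` to `2n - 1 - t`. Let `Y` be the vertex coordinates for the image of
the direction under the Veech involution `(u, v) ↦ (-u + 2 cot (π / 2n) v, v)`. Adding `potential X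
Y t` to the coordinate gives a quantity that is constant while the path advances and whose jumps
are, up to sign, the translations of the exchange `Y`. So derivation leads from words coded by `X`
to words coded by `Y` (`Renormalization.derive`), and interpolation leads back
(`Renormalization.generate`). The image directions fill the sectors `1, ..., 2n - 1`, and the sector
`j` of the image determines the group `j / 2`.

The theorem follows from a cycle of three inclusions. Limits of coded words are infinitely coherent,
because one renormalization step passes to the limit: there are finitely many sectors and the gaps
between sandwiched letters are bounded (`renormalize_closure`). Infinitely coherent words are
generated to every depth, because a word is recovered from its derived word and its group
(`isGenerated0_of_isDerived`). Words generated to every depth are limits of coded words, because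
every block of `k + 2` letters of a `k`-fold generated word occurs in a coded word
(`exists_realization_of_mem_generatedSet`). -/

theorem permHor_apply (a : ZMod n) : permHor n a = -a := rfl

theorem permSlant_apply (a : ZMod n) : permSlant n a = -a - 1 := rfl

theorem permHor_mul_permSlant_pow (k : ℕ) (a : ZMod n) :
    ((permHor n * permSlant n) ^ k) a = a + k := by
  induction k with
  | zero => simp
  | succ k ih =>
    rw [pow_succ', Equiv.Perm.mul_apply, ih, Equiv.Perm.mul_apply, permSlant_apply, permHor_apply]
    push_cast; ring

theorem permSlant_mul_permHor_pow (k : ℕ) (a : ZMod n) :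
    ((permSlant n * permHor n) ^ k) a = a - k := by
  induction k with
  | zero => simp
  | succ k ih =>
    rw [pow_succ', Equiv.Perm.mul_apply, ih, Equiv.Perm.mul_apply, permSlant_apply, permHor_apply]
    push_cast; ring

theorem perm_even (k : ℕ) (a : ZMod n) : perm n (2 * k) a = a + k := by
  rw [perm, if_pos (even_two_mul k), Nat.mul_div_cancel_left _ two_pos, permHor_mul_permSlant_pow]

theorem perm_odd (k : ℕ) (a : ZMod n) : perm n (2 * k + 1) a = -a - 1 - k := by
  rw [perm, if_neg (by simp), show (2 * k + 1) / 2 = k by omega, Equiv.Perm.mul_apply,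
    permSlant_mul_permHor_pow, permSlant_apply]

theorem perm_zero : perm n 0 = 1 := by
  ext a; simpa using perm_even 0 a

/-- The permutations `a ↦ c ± a` of the letters. -/
def IsDihedral (p : Equiv.Perm (ZMod n)) : Prop :=
  ∃ c : ZMod n, (∀ a, p a = a + c) ∨ ∀ a, p a = -a + c

theorem isDihedral_one : IsDihedral (1 : Equiv.Perm (ZMod n)) := ⟨0, Or.inl fun a => by simp⟩

theorem IsDihedral.mul {p q : Equiv.Perm (ZMod n)} (hp : IsDihedral p) (hq : IsDihedral q) :
    IsDihedral (p * q) := by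
  obtain ⟨c, hc⟩ := hp
  obtain ⟨d, hd⟩ := hq
  rcases hc with hc | hc <;> rcases hd with hd | hd
  · exact ⟨d + c, Or.inl fun a => by rw [Equiv.Perm.mul_apply, hc, hd]; ring⟩
  · exact ⟨d + c, Or.inr fun a => by rw [Equiv.Perm.mul_apply, hc, hd]; ring⟩
  · exact ⟨-d + c, Or.inr fun a => by rw [Equiv.Perm.mul_apply, hc, hd]; ring⟩
  · exact ⟨-d + c, Or.inl fun a => by rw [Equiv.Perm.mul_apply, hc, hd]; ring⟩

theorem IsDihedral.inv {p : Equiv.Perm (ZMod n)} (hp : IsDihedral p) : IsDihedral p⁻¹ := by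
  obtain ⟨c, hc | hc⟩ := hp
  · exact ⟨-c, Or.inl fun a => by rw [Equiv.Perm.inv_eq_iff_eq, hc]; ring⟩
  · exact ⟨c, Or.inr fun a => by rw [Equiv.Perm.inv_eq_iff_eq, hc]; ring⟩

theorem isDihedral_perm (i : ℕ) : IsDihedral (perm n i) := by
  rcases Nat.even_or_odd' i with ⟨k, rfl | rfl⟩
  · exact ⟨k, Or.inl (perm_even k)⟩
  · exact ⟨-1 - k, Or.inr fun a => by rw [perm_odd]; ring⟩

theorem IsDihedral.exists_eq_perm [NeZero n] {p : Equiv.Perm (ZMod n)} (hp : IsDihedral p) :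
    ∃ i < 2 * n, p = perm n i := by
  obtain ⟨c, hc | hc⟩ := hp
  · refine ⟨2 * c.val, by have := c.val_lt; omega, Equiv.ext fun a => ?_⟩
    rw [hc, perm_even, ZMod.natCast_zmod_val]
  · refine ⟨2 * (-1 - c).val + 1, by have := (-1 - c).val_lt; omega, Equiv.ext fun a => ?_⟩
    rw [hc, perm_odd, ZMod.natCast_zmod_val]; ring

theorem relabel_relabel (p q : Equiv.Perm (ZMod n)) (w : Word n) :
    relabel p (relabel q w) = relabel (p * q) w := rfl

theorem relabel_one (w : Word n) : relabel 1 w = w := rfl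

theorem relabel_inv_relabel (p : Equiv.Perm (ZMod n)) (w : Word n) :
    relabel p⁻¹ (relabel p w) = w := by
  rw [relabel_relabel, inv_mul_cancel, relabel_one]

theorem relabel_relabel_inv (p : Equiv.Perm (ZMod n)) (w : Word n) :
    relabel p (relabel p⁻¹ w) = w := by
  rw [relabel_relabel, mul_inv_cancel, relabel_one]

theorem mem_admissibleIn_iff {i : ℕ} {w : Word n} :
    w ∈ admissibleIn n i ↔ ∀ m : ℤ, Edge0 n (perm n i (w m)) (perm n i (w (m + 1))) := Iff.rfl

theorem mem_admissibleIn_iff_relabel {i : ℕ} {w : Word n} :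
    w ∈ admissibleIn n i ↔ relabel (perm n i) w ∈ admissibleIn n 0 := by
  simp [mem_admissibleIn_iff, perm_zero, relabel]

theorem mem_admissibleIn_zero {w : Word n} :
    w ∈ admissibleIn n 0 ↔ ∀ m : ℤ, Edge0 n (w m) (w (m + 1)) := by
  simp [mem_admissibleIn_iff, perm_zero]

theorem IsAdmissible.relabel [NeZero n] {w : Word n} (hw : IsAdmissible n w)
    {p : Equiv.Perm (ZMod n)} (hp : IsDihedral p) : IsAdmissible n (relabel p w) := by
  obtain ⟨i, -, hi⟩ := hw
  obtain ⟨j, hj, e⟩ := ((isDihedral_perm i).mul hp.inv).exists_eq_perm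
  refine ⟨j, hj, ?_⟩
  rw [mem_admissibleIn_iff_relabel] at hi ⊢
  rwa [← e, relabel_relabel, mul_assoc, inv_mul_cancel, mul_one]

theorem sandwiched_iff {w : Word n} {m : ℤ} : Sandwiched w m ↔ w (m + 1) = w (m - 1) :=
  ⟨fun ⟨_, h1, h2⟩ => h2.trans h1.symm, fun h => ⟨_, rfl, h⟩⟩

theorem sandwiched_relabel (p : Equiv.Perm (ZMod n)) {w : Word n} {m : ℤ} :
    Sandwiched (relabel p w) m ↔ Sandwiched w m := by
  simp [sandwiched_iff, relabel]

theorem IsDerived.relabel {w v : Word n} (h : IsDerived w v) (p : Equiv.Perm (ZMod n)) :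
    IsDerived (relabel p w) (relabel p v) := by
  obtain ⟨f, hf, hr, hv⟩ := h
  exact ⟨f, hf, by simpa [sandwiched_relabel] using hr, fun m => congrArg p (hv m)⟩

/-- The sum of two values is less than `2n`, so the congruences modulo `n` determine it, except that
`a = b = 0` also has sum divisible by `n`; this is what `a ≠ 0` excludes. -/
theorem edge0_iff [NeZero n] {a b : ZMod n} :
    Edge0 n a b ↔ b = -a - 1 ∨ b = -a ∧ a ≠ 0 := by
  have ha := a.val_lt
  have hb := b.val_lt
  have key : ∀ c : ℕ, ((c : ZMod n) = 0 ↔ n ∣ c) := fun c => ZMod.natCast_eq_zero_iff c n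
  have e1 : (b = -a - 1) ↔ n ∣ a.val + b.val + 1 := by
    rw [← key]; push_cast; rw [ZMod.natCast_zmod_val, ZMod.natCast_zmod_val]
    constructor
    · rintro rfl; ring
    · intro h; linear_combination h
  have e2 : (b = -a) ↔ n ∣ a.val + b.val := by
    rw [← key]; push_cast; rw [ZMod.natCast_zmod_val, ZMod.natCast_zmod_val]
    constructor
    · rintro rfl; ring
    · intro h; linear_combination h
  have e3 : a ≠ 0 ↔ a.val ≠ 0 := by simp [ZMod.val_eq_zero]
  rw [Edge0, e1, e2, e3]
  constructor
  · rintro (h | h)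
    · exact Or.inl ⟨1, by omega⟩
    · exact Or.inr ⟨⟨1, by omega⟩, by omega⟩
  · rintro (⟨c, hc⟩ | ⟨⟨c, hc⟩, h0⟩)
    · left
      have : c < 2 := by by_contra h; have : n * 2 ≤ n * c := Nat.mul_le_mul_left _ (by omega); omega
      interval_cases c <;> omega
    · right
      have : c < 2 := by by_contra h; have : n * 2 ≤ n * c := Nat.mul_le_mul_left _ (by omega); omega
      interval_cases c <;> omega

theorem Edge0.symm {a b : ZMod n} (h : Edge0 n a b) : Edge0 n b a := by
  unfold Edge0 at *; omega

/-! ### Places on the snake -/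

theorem snake_even (m : ℕ) : snake n (2 * m) = m := by
  rw [snake, if_pos (even_two_mul m), Nat.mul_div_cancel_left _ two_pos]

theorem snake_odd (m : ℕ) : snake n (2 * m + 1) = -((m : ZMod n) + 1) := by
  rw [snake, if_neg (by simp), show (2 * m + 1 + 1) / 2 = m + 1 by omega]; push_cast; rfl

/-- The reflection changes the parity of the place, hence the case of `snake`, and the two formulas
agree because `n = 0` in `ZMod n`. -/
theorem snake_reflect {t : ℕ} (ht : t < 2 * n) : snake n (2 * n - 1 - t) = snake n t := by
  rcases Nat.even_or_odd' t with ⟨m, rfl | rfl⟩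
  · rw [show 2 * n - 1 - 2 * m = 2 * (n - 1 - m) + 1 by omega, snake_odd, snake_even,
      Nat.cast_sub (by omega), Nat.cast_sub (by omega), ZMod.natCast_self]
    push_cast; ring
  · rw [show 2 * n - 1 - (2 * m + 1) = 2 * (n - 1 - m) by omega, snake_odd, snake_even,
      Nat.cast_sub (by omega), Nat.cast_sub (by omega), ZMod.natCast_self]
    push_cast; ring

theorem one_ne_zero_of_three_le (hn : 3 ≤ n) : (1 : ZMod n) ≠ 0 := by
  have : Fact (1 < n) := ⟨by omega⟩
  exact one_ne_zero

theorem slant_ne_hor (hn : 3 ≤ n) (a : ZMod n) : -a - 1 ≠ -a := by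
  intro h
  exact one_ne_zero_of_three_le hn (by linear_combination -h)

theorem natCast_ne_zero_of_lt {m : ℕ} (h0 : 0 < m) (h : m < n) : (m : ZMod n) ≠ 0 := by
  rw [Ne, ZMod.natCast_eq_zero_iff]
  exact Nat.not_dvd_of_pos_of_lt h0 h

theorem edge0_snake [NeZero n] {t : ℕ} (ht : t + 1 < 2 * n) :
    Edge0 n (snake n t) (snake n (t + 1)) := by
  rw [edge0_iff]
  rcases Nat.even_or_odd' t with ⟨m, rfl | rfl⟩
  · left; rw [snake_even, snake_odd]; ring
  · right
    rw [show 2 * m + 1 + 1 = 2 * (m + 1) by ring, snake_odd, snake_even]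
    refine ⟨by push_cast; ring, ?_⟩
    have := natCast_ne_zero_of_lt (n := n) (m := m + 1) (by omega) (by omega)
    push_cast at this
    exact neg_ne_zero.mpr this

/-- A letter which follows `snake n t` and differs from the letter before it continues the snake. -/
theorem eq_snake_of_edge0 [NeZero n] (hn : 3 ≤ n) {t : ℕ} (h1 : 1 ≤ t) (ht : t < 2 * n)
    {b : ZMod n} (hb : Edge0 n (snake n t) b) (hne : b ≠ snake n (t - 1)) :
    t + 1 < 2 * n ∧ b = snake n (t + 1) := by
  rw [edge0_iff] at hb
  rcases Nat.even_or_odd' t with ⟨m, rfl | rfl⟩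
  · obtain ⟨m, rfl⟩ : ∃ k, m = k + 1 := ⟨m - 1, by omega⟩
    rw [show 2 * (m + 1) - 1 = 2 * m + 1 by omega, snake_odd] at hne
    rw [snake_even] at hb
    rw [snake_odd]
    push_cast at hb hne ⊢
    rcases hb with hb | hb
    · exact ⟨by omega, by rw [hb]; ring⟩
    · exact absurd hb.1 hne
  · rw [show 2 * m + 1 - 1 = 2 * m by omega, snake_even] at hne
    rw [snake_odd] at hb
    rw [show 2 * m + 1 + 1 = 2 * (m + 1) by ring, snake_even]
    rcases hb with hb | ⟨hb, h0⟩
    · exact absurd (by rw [hb]; ring) hne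
    · refine ⟨?_, by rw [hb]; push_cast; ring⟩
      by_contra h
      obtain rfl : n = m + 1 := by omega
      apply h0
      have := ZMod.natCast_self (m + 1)
      push_cast at this
      rw [this, neg_zero]

/-- The place on the snake at which the letter `a` is followed by `groupLetter n l a`. -/
def startPlace (n l : ℕ) (a : ZMod n) : ℕ :=
  if a.val + 1 + l ≤ n then 2 * a.val else 2 * (n - a.val) - 1

theorem startPlace_lt [NeZero n] {l : ℕ} (hl : l < n) (a : ZMod n) :
    startPlace n l a + 1 < 2 * n := by
  have := a.val_lt
  unfold startPlace; split_ifs <;> omega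

theorem snake_startPlace [NeZero n] {l : ℕ} (a : ZMod n) :
    snake n (startPlace n l a) = a := by
  have := a.val_lt
  unfold startPlace; split_ifs
  · rw [snake_even, ZMod.natCast_zmod_val]
  · rw [show 2 * (n - a.val) - 1 = 2 * (n - a.val - 1) + 1 by omega, snake_odd,
      Nat.cast_sub (by omega), Nat.cast_sub (by omega), ZMod.natCast_self, ZMod.natCast_zmod_val]
    push_cast; ring

theorem snake_startPlace_add_one [NeZero n] {l : ℕ} (a : ZMod n) :
    snake n (startPlace n l a + 1) = groupLetter n l a := by
  have := a.val_lt
  unfold startPlace groupLetter; split_ifs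
  · rw [snake_odd, ZMod.natCast_zmod_val, permSlant_apply]; ring
  · rw [show 2 * (n - a.val) - 1 + 1 = 2 * (n - a.val) by omega, snake_even,
      Nat.cast_sub (by omega), ZMod.natCast_self, ZMod.natCast_zmod_val, permHor_apply]
    ring

/-- A letter `a` is followed by `-a - 1` at its even place and by `-a` at its odd place. These
differ, so the successor decides between the two places. -/
theorem eq_startPlace [NeZero n] (hn : 3 ≤ n) {l t : ℕ} (ht : t + 1 < 2 * n)
    (h : snake n (t + 1) = groupLetter n l (snake n t)) : t = startPlace n l (snake n t) := by
  unfold groupLetter at h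
  unfold startPlace
  rcases Nat.even_or_odd' t with ⟨m, rfl | rfl⟩
  · have hv : (snake n (2 * m)).val = m := by rw [snake_even, ZMod.val_natCast_of_lt (by omega)]
    split_ifs at h with hc
    · rw [if_pos hc, hv]
    · rw [snake_odd, snake_even, permHor_apply] at h
      exact absurd (by linear_combination h) (slant_ne_hor hn (m : ZMod n))
  · have hv : (snake n (2 * m + 1)).val = n - (m + 1) := by
      have : snake n (2 * m + 1) = ((n - (m + 1) : ℕ) : ZMod n) := by
        rw [snake_odd, Nat.cast_sub (by omega), ZMod.natCast_self]; push_cast; ring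
      rw [this, ZMod.val_natCast_of_lt (by omega)]
    split_ifs at h with hc
    · rw [show 2 * m + 1 + 1 = 2 * (m + 1) by ring, snake_odd, snake_even, permSlant_apply] at h
      push_cast at h
      exact absurd (by linear_combination -h) (slant_ne_hor hn ((m : ZMod n)))
    · rw [if_neg hc, hv]; omega

/-- Reading the palindrome backwards turns predecessors into successors. -/
theorem eq_reflect_startPlace [NeZero n] (hn : 3 ≤ n) {l t : ℕ} (h1 : 1 ≤ t) (ht : t < 2 * n)
    (h : snake n (t - 1) = groupLetter n l (snake n t)) :
    t = 2 * n - 1 - startPlace n l (snake n t) := by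
  have := eq_startPlace (n := n) hn (l := l) (t := 2 * n - 1 - t) (by omega) (by
    rw [snake_reflect ht, ← h, ← snake_reflect (t := t - 1) (by omega)]
    congr 1; omega)
  rw [snake_reflect ht] at this
  omega

theorem snake_reflect_startPlace_sub_one [NeZero n] {l : ℕ} (hl : l < n) (a : ZMod n) :
    snake n (2 * n - 1 - startPlace n l a - 1) = groupLetter n l a := by
  have h := startPlace_lt hl a
  rw [← snake_startPlace_add_one, ← snake_reflect (t := startPlace n l a + 1) h]
  congr 1

theorem snake_reflect_startPlace [NeZero n] {l : ℕ} (hl : l < n) (a : ZMod n) :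
    snake n (2 * n - 1 - startPlace n l a) = a := by
  have h := startPlace_lt hl a
  rw [snake_reflect (by omega), snake_startPlace]

/-- The word between the places `t` and `t'` of the snake interpolates iff these places are the
right ones. -/
theorem isInterpolatingWord_iff [NeZero n] (hn : 3 ≤ n) {j : ℕ} (hj : j < 2 * n) {a b : ZMod n}
    {u : List (ZMod n)} :
    IsInterpolatingWord n j a b u ↔
      startPlace n (j / 2) a < 2 * n - 1 - startPlace n (j / 2) b ∧
      u = (List.range' (startPlace n (j / 2) a + 1)
        (2 * n - 1 - startPlace n (j / 2) b - startPlace n (j / 2) a - 1)).map (snake n) := by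
  have hl : j / 2 < n := by omega
  have head : ∀ t t' : ℕ, t < t' →
      ((List.range' (t + 1) (t' - t - 1)).map (snake n) ++ [snake n t']).head? =
        some (snake n (t + 1)) := by
    intro t t' h
    obtain ⟨d, rfl⟩ : ∃ d, t' = t + 1 + d := ⟨t' - (t + 1), by omega⟩
    rw [show t + 1 + d - t - 1 = d by omega]
    cases d with
    | zero => simp
    | succ d => simp [List.range'_succ]
  have last : ∀ t t' : ℕ, t < t' →
      (snake n t :: (List.range' (t + 1) (t' - t - 1)).map (snake n)).getLast? =
        some (snake n (t' - 1)) := by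
    intro t t' h
    obtain ⟨d, rfl⟩ : ∃ d, t' = t + 1 + d := ⟨t' - (t + 1), by omega⟩
    rw [show t + 1 + d - t - 1 = d by omega, ← List.map_cons,
      show t :: List.range' (t + 1) d = List.range' t (d + 1) by rw [List.range'_succ],
      List.range'_concat]
    simp
  constructor
  · rintro ⟨⟨t, t', htt, ht', rfl, rfl, rfl⟩, hh, hg⟩
    rw [head t t' htt, Option.some_inj] at hh
    rw [last t t' htt, Option.some_inj] at hg
    have e1 := eq_startPlace hn (by omega) hh
    have e2 := eq_reflect_startPlace hn (by omega) ht' hg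
    rw [← e1, ← e2]
    exact ⟨htt, rfl⟩
  · rintro ⟨h, rfl⟩
    have hlast := last _ _ h
    have hhead := head _ _ h
    rw [snake_startPlace] at hlast
    rw [snake_reflect_startPlace hl] at hhead
    refine ⟨⟨_, _, h, by omega, snake_startPlace a, snake_reflect_startPlace hl b, rfl⟩, ?_, ?_⟩
    · rw [hhead, snake_startPlace_add_one]
    · rw [hlast, snake_reflect_startPlace_sub_one hl]

end Letters

/-! ### Bi-infinite sequences -/

theorem exists_int_primitive {M : Type*} [AddCommGroup M] (g : ℤ → M) :
    ∃ S : ℤ → M, S 0 = 0 ∧ ∀ k, S (k + 1) = S k + g k := by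
  refine ⟨fun k => match k with
    | Int.ofNat m => ∑ i ∈ Finset.range m, g i
    | Int.negSucc m => -∑ i ∈ Finset.range (m + 1), g (Int.negSucc i), by simp, fun k => ?_⟩
  match k with
  | Int.ofNat m =>
    change ∑ i ∈ Finset.range (m + 1), g i = _
    rw [Finset.sum_range_succ]; rfl
  | Int.negSucc 0 =>
    change ∑ i ∈ Finset.range 0, g i = -∑ i ∈ Finset.range 1, g (Int.negSucc i) + _
    simp
  | Int.negSucc (m + 1) =>
    change -∑ i ∈ Finset.range (m + 1), g (Int.negSucc i) =
      -∑ i ∈ Finset.range (m + 1 + 1), g (Int.negSucc i) + _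
    rw [Finset.sum_range_succ _ (m + 1)]; abel

theorem strictMono_int_add_le {f : ℤ → ℤ} (hf : StrictMono f) {a b : ℤ} (h : a ≤ b) :
    f a + (b - a) ≤ f b := by
  induction b, h using Int.leInduction with
  | base => simp
  | succ b _ ih => have := hf (show b < b + 1 by omega); omega

theorem exists_le_lt_of_strictMono {f : ℤ → ℤ} (hf : StrictMono f) (k : ℤ) :
    ∃ m, f m ≤ k ∧ k < f (m + 1) := by
  obtain ⟨m, hm, hmax⟩ := Int.exists_greatest_of_bdd (P := fun m => f m ≤ k)
    ⟨max 0 (k - f 0), fun z hz => by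
      by_contra h
      have := strictMono_int_add_le hf (show 0 ≤ z by omega)
      omega⟩
    ⟨min 0 (k - f 0), by
      have := strictMono_int_add_le hf (show min 0 (k - f 0) ≤ 0 by omega)
      omega⟩
  exact ⟨m, hm, by by_contra h; have := hmax (m + 1) (by omega); omega⟩

/-- Concatenation of finite blocks to a bi-infinite sequence. -/
theorem exists_concat {α : Type*} {f : ℤ → ℤ} (hf : StrictMono f) (P : ℤ → ℕ → α) :
    ∃ W : ℤ → α, ∀ (m : ℤ) (r : ℕ), f m + r < f (m + 1) → W (f m + r) = P m r := by
  choose idx h1 h2 using exists_le_lt_of_strictMono hf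
  refine ⟨fun k => P (idx k) (k - f (idx k)).toNat, fun m r hr => ?_⟩
  have e : idx (f m + r) = m := by
    have a1 := hf.lt_iff_lt.1 (lt_of_le_of_lt (h1 (f m + r)) hr)
    have a2 := hf.lt_iff_lt.1 (lt_of_le_of_lt (show f m ≤ f m + r by omega) (h2 (f m + r)))
    omega
  simp [e]

/-! ### Words coded by an exchange of flipped intervals

For the direction `(u, v)` the number `vertexCoord n u v a` is the coordinate of a vertex of the
polygon transversally to the direction. -/

/-- `w` codes an orbit of the interval exchange with end points `X a`. -/
def IsCoded (n : ℕ) (X : ℤ → ℝ) (w : Word n) : Prop :=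
  ∃ (x : ℤ → ℝ) (A : ℤ → ℤ), ∀ k, (A k : ZMod n) = w k ∧ X (A k + 1) < x k ∧ x k < X (A k) ∧
    x (k + 1) = x k - X (A k) - X (A k + 1)

theorem IsCoded.shift {n : ℕ} {X : ℤ → ℝ} {w : Word n} (h : IsCoded n X w) (s : ℤ) :
    IsCoded n X fun k => w (k + s) := by
  obtain ⟨x, A, h⟩ := h
  exact ⟨fun k => x (k + s), fun k => A (k + s), fun k => by
    have := h (k + s); rwa [show k + s + 1 = k + 1 + s by ring] at this⟩

theorem IsCoded.smul {n : ℕ} {X : ℤ → ℝ} {w : Word n} (h : IsCoded n X w) {c : ℝ} (hc : 0 < c) :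
    IsCoded n (fun a => c * X a) w := by
  obtain ⟨x, A, h⟩ := h
  refine ⟨fun k => c * x k, A, fun k => ?_⟩
  obtain ⟨h1, h2, h3, h4⟩ := h k
  exact ⟨h1, mul_lt_mul_of_pos_left h2 hc, mul_lt_mul_of_pos_left h3 hc, by
    simp only [h4]; ring⟩

/-- The representative of `A` in the window differs from `A` by a multiple of `n`. An odd multiple,
which leads to the opposite side, would reverse the strict inequality although `X` decreases on the
window; an even multiple leaves `X` unchanged. -/
theorem exists_lift_mem {n : ℕ} (hn : 0 < n) {X : ℤ → ℝ} (hX : Function.Antiperiodic X (n : ℤ))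
    {c : ℤ} (hc : ∀ a, c ≤ a → a < c + n → X (a + 1) ≤ X a) {A : ℤ} (hA : X (A + 1) < X A) :
    ∃ B, c ≤ B ∧ B < c + n ∧ (B : ZMod n) = A ∧ X B = X A ∧ X (B + 1) = X (A + 1) := by
  have hn' : (0 : ℤ) < n := by exact_mod_cast hn
  have h1 := Int.emod_nonneg (A - c) hn'.ne'
  have h2 := Int.emod_lt_of_pos (A - c) hn'
  have h3 := Int.emod_add_mul_ediv (A - c) n
  set q := (A - c) / n
  have key : A = c + (A - c) % n + q * n := by linarith
  refine ⟨c + (A - c) % n, by omega, by omega, ?_, ?_⟩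
  · conv_rhs => rw [key]
    push_cast; simp
  · rcases Int.even_or_odd' q with ⟨r, hr | hr⟩
    · have hp : Function.Periodic X (q * n) := by
        have := hX.int_even_mul_periodic r
        rwa [hr, show 2 * r * (n : ℤ) = r * (2 * n) by ring]
      constructor
      · conv_rhs => rw [key]
        exact (hp _).symm
      · conv_rhs => rw [key]
        rw [show c + (A - c) % n + q * n + 1 = c + (A - c) % n + 1 + q * n by ring]
        exact (hp _).symm
    · exfalso
      have hp : Function.Antiperiodic X (q * n) := by
        have := hX.int_odd_mul_antiperiodic r
        rwa [hr, show (2 * r + 1) * (n : ℤ) = r * (2 * n) + n by ring]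
      have e1 := hp (c + (A - c) % n)
      have e2 := hp (c + (A - c) % n + 1)
      rw [show c + (A - c) % n + 1 + q * n = c + (A - c) % n + q * n + 1 by ring, ← key] at e2
      rw [← key] at e1
      have := hc (c + (A - c) % n) (by omega) (by omega)
      linarith

theorem IsCoded.exists_lift_mem {n : ℕ} (hn : 0 < n) {X : ℤ → ℝ}
    (hX : Function.Antiperiodic X (n : ℤ)) {c : ℤ}
    (hc : ∀ a, c ≤ a → a < c + n → X (a + 1) ≤ X a) {w : Word n} (h : IsCoded n X w) :
    ∃ (x : ℤ → ℝ) (A : ℤ → ℤ), (∀ k, c ≤ A k ∧ A k < c + n) ∧ ∀ k, (A k : ZMod n) = w k ∧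
      X (A k + 1) < x k ∧ x k < X (A k) ∧ x (k + 1) = x k - X (A k) - X (A k + 1) := by
  obtain ⟨x, A, h⟩ := h
  choose B h1 h2 h3 h4 h5 using fun k =>
    TwoNGon.exists_lift_mem hn hX hc ((h k).2.1.trans (h k).2.2.1)
  exact ⟨x, B, fun k => ⟨h1 k, h2 k⟩, fun k => by rw [h3, h4, h5]; exact h k⟩

/-! ### Renormalization -/

/-- The interval exchanges with end points `X` and `Y` belong to a direction in the sector
`[0, π / 2n]` and to its image under the Veech involution. -/
structure Renormalization (n l : ℕ) (X Y : ℤ → ℝ) : Prop where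
  lt : l < n
  antiX : Function.Antiperiodic X (n : ℤ)
  antiY : Function.Antiperiodic Y (n : ℤ)
  -- For vertex coordinates, `Y + X` is proportional to `cos (2 m * halfAngle n)` and `Y - X` to
  -- `cos ((2 m - 1) * halfAngle n)`. These two symmetries are all that is used of the Veech
  -- involution.
  even (m : ℤ) : Y m + X m = Y (-m) + X (-m)
  odd (m : ℤ) : Y m - X m = Y (1 - m) - X (1 - m)
  -- The next two inequalities express that the direction of `X` is in `[0, π / 2n]`; `antitone`
  -- expresses that the direction of `Y` is in the sector `2l` or `2l + 1`.
  neg_le (m : ℤ) : 0 ≤ m → m ≤ n → X (-m) ≤ X m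
  le_one_sub (m : ℤ) : 1 ≤ m → m ≤ n → X m ≤ X (1 - m)
  antitone (a : ℤ) : -(l : ℤ) ≤ a → a < -l + n → Y (a + 1) ≤ Y a

/-- The lift to `ℤ` of the letter at place `t` of the snake. -/
def snakeLift (n t : ℕ) : ℤ := if Even t then ((t / 2 : ℕ) : ℤ) else n - ((t + 1) / 2 : ℕ)

/-- The coordinate change at place `t` of the snake. -/
noncomputable def potential (X Y : ℤ → ℝ) (t : ℕ) : ℝ :=
  if Even t then Y (t / 2 : ℕ) - X (-(t / 2 : ℕ)) else Y ((t + 1) / 2 : ℕ) + X (1 - ((t + 1) / 2 : ℕ))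

/-- The interval of the trajectories which run along the snake from place `t` to place `t + 1`. -/
def InStrip (Y : ℤ → ℝ) (t : ℕ) (y : ℝ) : Prop :=
  Y ((t + 2) / 2 : ℕ) < y ∧ y < Y (-((t + 1) / 2 : ℕ))

section

variable {n l : ℕ} {X Y : ℤ → ℝ}

theorem snakeLift_even (m : ℕ) : snakeLift n (2 * m) = m := by
  rw [snakeLift, if_pos (even_two_mul m), Nat.mul_div_cancel_left _ two_pos]

theorem snakeLift_odd (m : ℕ) : snakeLift n (2 * m + 1) = n - (m + 1) := by
  rw [snakeLift, if_neg (by simp), show (2 * m + 1 + 1) / 2 = m + 1 by omega]; push_cast; rfl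

theorem potential_even (m : ℕ) : potential X Y (2 * m) = Y m - X (-m) := by
  rw [potential, if_pos (even_two_mul m), Nat.mul_div_cancel_left _ two_pos]

theorem potential_odd (m : ℕ) : potential X Y (2 * m + 1) = Y (m + 1) + X (-m) := by
  rw [potential, if_neg (by simp), show (2 * m + 1 + 1) / 2 = m + 1 by omega]
  push_cast
  rw [show 1 - ((m : ℤ) + 1) = -m by ring]

theorem inStrip_even (m : ℕ) (y : ℝ) : InStrip Y (2 * m) y ↔ Y (m + 1) < y ∧ y < Y (-m) := by
  rw [InStrip, show (2 * m + 2) / 2 = m + 1 by omega, show (2 * m + 1) / 2 = m by omega]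
  push_cast; rfl

theorem inStrip_odd (m : ℕ) (y : ℝ) :
    InStrip Y (2 * m + 1) y ↔ Y (m + 1) < y ∧ y < Y (-(m + 1)) := by
  rw [InStrip, show (2 * m + 1 + 2) / 2 = m + 1 by omega, show (2 * m + 1 + 1) / 2 = m + 1 by omega]
  push_cast; rfl

theorem snakeLift_cast (t : ℕ) : (snakeLift n t : ZMod n) = snake n t := by
  rcases Nat.even_or_odd' t with ⟨m, rfl | rfl⟩
  · rw [snakeLift_even, snake_even]; push_cast; rfl
  · rw [snakeLift_odd, snake_odd]; push_cast; rw [ZMod.natCast_self]; ring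

theorem eq_or_eq_of_snakeLift_eq {t t' : ℕ} (h : snakeLift n t = snakeLift n t') :
    t' = t ∨ t' = 2 * n - 1 - t := by
  rcases Nat.even_or_odd' t with ⟨m, rfl | rfl⟩ <;> rcases Nat.even_or_odd' t' with ⟨m', rfl | rfl⟩ <;>
    simp only [snakeLift_even, snakeLift_odd] at h <;> omega

theorem antiperiodic_natCast_sub (h : Function.Antiperiodic Y (n : ℤ)) (a : ℤ) :
    Y (n - a) = -Y (-a) := by
  rw [← h (-a)]; congr 1; ring

end

/-! ### Orbits of the exchange `X` as paths on the snake, and their derivation -/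

namespace Renormalization

variable {n l : ℕ} {X Y : ℤ → ℝ}

theorem pos (R : Renormalization n l X Y) : 0 < n := lt_of_le_of_lt (Nat.zero_le _) R.lt

theorem antitoneX (R : Renormalization n l X Y) (a : ℤ) (h0 : 0 ≤ a) (h : a < n) :
    X (a + 1) ≤ X a := by
  have h1 := R.neg_le a h0 h.le
  have h2 := R.le_one_sub (a + 1) (by omega) (by omega)
  rw [show 1 - (a + 1) = -a by ring] at h2
  exact h2.trans h1

theorem X_sub (R : Renormalization n l X Y) (a : ℤ) : X (n - a) = -X (-a) :=
  antiperiodic_natCast_sub R.antiX a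

theorem Y_sub (R : Renormalization n l X Y) (a : ℤ) : Y (n - a) = -Y (-a) :=
  antiperiodic_natCast_sub R.antiY a

theorem antitone_of_le (R : Renormalization n l X Y) {a b : ℤ} (h0 : -(l : ℤ) ≤ a) (hab : a ≤ b)
    (h : b ≤ -l + n) : Y b ≤ Y a := by
  induction b, hab using Int.leInduction with
  | base => exact le_rfl
  | succ b hb ih => exact (R.antitone b (by omega) (by omega)).trans (ih (by omega))

theorem monotone_of_le (R : Renormalization n l X Y) {a b : ℤ} (h0 : -(l : ℤ) + n ≤ a) (hab : a ≤ b)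
    (h : b ≤ -l + n + n) : Y a ≤ Y b := by
  have := R.antitone_of_le (a := a - n) (b := b - n) (by omega) (by omega) (by omega)
  have e1 := R.antiY (a - n)
  have e2 := R.antiY (b - n)
  rw [sub_add_cancel] at e1 e2
  linarith

theorem monotone_of_le' (R : Renormalization n l X Y) {a b : ℤ} (h0 : -(l : ℤ) - n ≤ a)
    (hab : a ≤ b) (h : b ≤ -l) : Y a ≤ Y b := by
  have := R.antitone_of_le (a := a + n) (b := b + n) (by omega) (by omega) (by omega)
  have e1 := R.antiY a
  have e2 := R.antiY b
  linarith

/-- The increment compensates the translation of the exchange `X`, so that coordinate plus potential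
is constant along the snake. At even places this combines the symmetries `even` and `odd`; at odd
places antiperiodicity suffices. -/
theorem potential_succ (R : Renormalization n l X Y) (t : ℕ) :
    potential X Y (t + 1) = potential X Y t + X (snakeLift n t) + X (snakeLift n t + 1) := by
  rcases Nat.even_or_odd' t with ⟨m, rfl | rfl⟩
  · rw [potential_even, potential_odd, snakeLift_even]
    have h1 := R.even m
    have h2 := R.odd (m + 1)
    rw [show 1 - ((m : ℤ) + 1) = -m by ring] at h2
    linarith
  · rw [show 2 * m + 1 + 1 = 2 * (m + 1) by ring, potential_even, potential_odd, snakeLift_odd,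
      R.X_sub, show (n : ℤ) - (m + 1) + 1 = n - m by ring, R.X_sub]
    push_cast
    ring

/-- The coordinate change at a sandwiched letter. -/
theorem potential_reflect (R : Renormalization n l X Y) {m : ℕ} (hm : m < n) :
    potential X Y (2 * n - 1 - 2 * m) - potential X Y (2 * m) = -Y m - Y (m + 1) := by
  rw [show 2 * n - 1 - 2 * m = 2 * (n - 1 - m) + 1 by omega, potential_even, potential_odd]
  have h2 := R.odd (m + 1)
  rw [show 1 - ((m : ℤ) + 1) = -m by ring] at h2
  rw [show ((n - 1 - m : ℕ) : ℤ) + 1 = n - m by omega,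
    show (-((n - 1 - m : ℕ) : ℤ)) = (m + 1) - n by omega, R.Y_sub,
    show X ((m + 1) - n) = -X (m + 1) by rw [← neg_eq_iff_eq_neg, ← R.antiX, sub_add_cancel]]
  linarith

/-- One end of the strip is an end of the slot of the letter at `t`; the other comes from the slot
of the letter at `t + 1`, and the inequalities of the sector make it the stronger bound. -/
theorem slot_of_inStrip (R : Renormalization n l X Y) {t : ℕ} (ht : t + 1 < 2 * n) {y : ℝ}
    (h : InStrip Y t y) :
    X (snakeLift n t + 1) < y - potential X Y t ∧ y - potential X Y t < X (snakeLift n t) := by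
  have hsucc := R.potential_succ t
  rcases Nat.even_or_odd' t with ⟨m, rfl | rfl⟩
  · rw [inStrip_even] at h
    rw [potential_odd, snakeLift_even] at hsucc
    rw [snakeLift_even]
    have h1 := R.even m
    have h2 := R.neg_le m (by omega) (by omega)
    have h3 := potential_even (X := X) (Y := Y) m
    constructor <;> linarith
  · rw [inStrip_odd] at h
    rw [show 2 * m + 1 + 1 = 2 * (m + 1) by ring, potential_even, snakeLift_odd] at hsucc
    rw [snakeLift_odd]
    push_cast at hsucc
    have h1 := R.even (m + 1)
    have h2 := R.le_one_sub (n - (m + 1) + 1) (by omega) (by omega)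
    rw [show (1 : ℤ) - (n - (m + 1) + 1) = -(n - (m + 1)) by ring] at h2
    have h3 := potential_odd (X := X) (Y := Y) m
    have h4 := R.X_sub m
    rw [show (n : ℤ) - m = n - (m + 1) + 1 by ring] at h4
    have h5 := R.X_sub (m + 1)
    have h6 : X (-(n - (m + 1))) = -X (m + 1) := by
      rw [← neg_eq_iff_eq_neg, ← R.antiX]; congr 1; ring
    constructor <;> linarith

/-- An orbit of the exchange `X` is a path on the snake, which is reflected at the sandwiched
letters. -/
theorem exists_path [NeZero n] (R : Renormalization n l X Y) {w : Word n} (h : IsCoded n X w) :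
    ∃ (T : ℤ → ℕ) (y : ℤ → ℝ), ∀ k, T k + 1 < 2 * n ∧ snake n (T k) = w k ∧
      snake n (T k + 1) = w (k + 1) ∧ InStrip Y (T k) (y k) ∧
      ((T (k + 1) = T k + 1 ∧ y (k + 1) = y k) ∨
        (T (k + 1) = 2 * n - 1 - (T k + 1) ∧
          y (k + 1) - y k = potential X Y (2 * n - 1 - (T k + 1)) - potential X Y (T k + 1))) := by
  obtain ⟨x, A, hA, h⟩ := h.exists_lift_mem R.pos R.antiX (c := 0)
    (fun a h1 h2 => R.antitoneX a h1 (by omega))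
  have antiX : ∀ {a b : ℤ}, 0 ≤ a → a ≤ b → b ≤ n → X b ≤ X a := by
    intro a b h0 hab hb
    induction b, hab using Int.leInduction with
    | base => exact le_rfl
    | succ b hb' ih => exact (R.antitoneX b (by omega) (by omega)).trans (ih (by omega))
  -- The image of the slot of `A k` is the interval from `-X (A k)` to `-X (A k + 1)`, which by the
  -- inequalities of the sector meets only these two slots.
  have edge : ∀ k, A (k + 1) = n - 1 - A k ∨ A (k + 1) = n - A k := by
    intro k
    have a1 := hA k
    have a2 := hA (k + 1)
    obtain ⟨-, h1, h2, h3⟩ := h k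
    obtain ⟨-, h4, h5, -⟩ := h (k + 1)
    by_contra hc
    rcases lt_or_ge (A (k + 1)) (n - 1 - A k) with hlt | hge
    · have b1 := antiX (a := A (k + 1) + 1) (b := n - (A k + 1)) (by omega) (by omega) (by omega)
      rw [R.X_sub] at b1
      have b2 := R.neg_le (A k + 1) (by omega) (by omega)
      linarith
    · have b1 := antiX (a := n - (A k - 1)) (b := A (k + 1)) (by omega) (by omega) (by omega)
      rw [R.X_sub, show -(A k - 1) = 1 - A k by ring] at b1
      have b2 := R.le_one_sub (A k) (by omega) (by omega)
      linarith
  have place : ∀ k, ∃ t : ℕ, t + 1 < 2 * n ∧ snakeLift n t = A k ∧ snakeLift n (t + 1) = A (k + 1) ∧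
      InStrip Y t (x k + potential X Y t) := by
    intro k
    have a1 := hA k
    have a2 := hA (k + 1)
    obtain ⟨-, h1, h2, h3⟩ := h k
    obtain ⟨-, h4, h5, -⟩ := h (k + 1)
    rcases edge k with he | he
    · obtain ⟨m, hm⟩ : ∃ m : ℕ, A k = m := ⟨(A k).toNat, by omega⟩
      refine ⟨2 * m, by omega, by rw [snakeLift_even, hm], by rw [snakeLift_odd]; omega, ?_⟩
      rw [inStrip_even]
      have hp := potential_even (X := X) (Y := Y) m
      have hsucc := R.potential_succ (2 * m)
      rw [potential_odd, snakeLift_even] at hsucc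
      have e1 := R.even m
      rw [he, show (n : ℤ) - 1 - A k + 1 = n - A k by ring, R.X_sub] at h4
      rw [hm] at h1 h2 h3 h4
      constructor <;> linarith
    · obtain ⟨m, hm⟩ : ∃ m : ℕ, A (k + 1) = m + 1 := ⟨(A (k + 1) - 1).toNat, by omega⟩
      have hm' : A k = n - (m + 1) := by omega
      refine ⟨2 * m + 1, by omega, by rw [snakeLift_odd, hm'], by
        rw [show 2 * m + 1 + 1 = 2 * (m + 1) by ring, snakeLift_even, hm]; push_cast; rfl, ?_⟩
      rw [inStrip_odd]
      have hp := potential_odd (X := X) (Y := Y) m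
      have hsucc := R.potential_succ (2 * m + 1)
      rw [show 2 * m + 1 + 1 = 2 * (m + 1) by ring, potential_even, snakeLift_odd] at hsucc
      push_cast at hsucc
      have e1 := R.even (m + 1)
      rw [hm', show (n : ℤ) - (m + 1) + 1 = n - m by ring, R.X_sub] at h1
      rw [hm] at h4 h5
      rw [hm'] at h2 h3
      constructor <;> linarith
  choose T hT1 hT2 hT3 hT4 using place
  refine ⟨T, fun k => x k + potential X Y (T k), fun k => ⟨hT1 k, ?_, ?_, hT4 k, ?_⟩⟩
  · rw [← snakeLift_cast, hT2, (h k).1]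
  · rw [← snakeLift_cast, hT3, (h (k + 1)).1]
  · have e := R.potential_succ (T k)
    have hx := (h k).2.2.2
    rw [hT2] at e
    -- The same letter stands at the places `T k + 1` and `T (k + 1)`, so these are equal or mirror
    -- images.
    rcases eq_or_eq_of_snakeLift_eq ((hT3 k).trans (hT2 (k + 1)).symm) with h1 | h1
    · exact Or.inl ⟨h1, by simp only [h1]; linarith⟩
    · exact Or.inr ⟨h1, by simp only [h1]; linarith⟩

theorem snake_add_two_ne (hn : 3 ≤ n) (t : ℕ) : snake n (t + 2) ≠ snake n t := by
  intro h
  apply one_ne_zero_of_three_le hn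
  rcases Nat.even_or_odd' t with ⟨m, rfl | rfl⟩
  · rw [show 2 * m + 2 = 2 * (m + 1) by ring, snake_even, snake_even] at h
    push_cast at h
    linear_combination h
  · rw [show 2 * m + 1 + 2 = 2 * (m + 1) + 1 by ring, snake_odd, snake_odd] at h
    push_cast at h
    linear_combination -h

/-- The derived word of a word coded by `X` is coded by `Y`. -/
theorem derive [NeZero n] (hn : 3 ≤ n) (R : Renormalization n l X Y) {w : Word n}
    (h : IsCoded n X w) :
    w ∈ admissibleIn n 0 ∧ InGroup n l w ∧
      (∀ k : ℤ, ∃ k', k < k' ∧ k' ≤ k + 2 * n ∧ Sandwiched w k') ∧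
      ∀ v, IsDerived w v → IsCoded n Y v := by
  obtain ⟨T, y, h⟩ := R.exists_path h
  have not_sand : ∀ k, ¬Sandwiched w (k + 1) → T (k + 1) = T k + 1 ∧ y (k + 1) = y k := by
    intro k hk
    rcases (h k).2.2.2.2 with h1 | ⟨h1, -⟩
    · exact h1
    · refine absurd (sandwiched_iff.2 ?_) hk
      rw [add_sub_cancel_right, ← (h (k + 1)).2.2.1, ← (h k).2.1, h1,
        ← snake_reflect (t := T k) (by have := (h k).1; omega)]
      have := (h k).1
      congr 1; omega
  have sand : ∀ k, Sandwiched w (k + 1) → T (k + 1) = 2 * n - 1 - (T k + 1) ∧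
      y (k + 1) - y k = potential X Y (2 * n - 1 - (T k + 1)) - potential X Y (T k + 1) := by
    intro k hk
    rcases (h k).2.2.2.2 with ⟨h1, -⟩ | h1
    · rw [sandwiched_iff, add_sub_cancel_right, ← (h (k + 1)).2.2.1, ← (h k).2.1, h1] at hk
      exact absurd hk (snake_add_two_ne hn _)
    · exact h1
  -- the slot of the arriving point, with its lift
  have slot : ∀ k, Sandwiched w (k + 1) → ∃ B : ℤ, (B : ZMod n) = w (k + 1) ∧
      Y (B + 1) < -y k ∧ -y k < Y B ∧ -y (k + 1) = -y k - Y B - Y (B + 1) ∧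
      w k = groupLetter n l (w (k + 1)) := by
    intro k hk
    obtain ⟨hs1, hs2⟩ := sand k hk
    obtain ⟨ht, hw, hw', hin, -⟩ := h k
    have hin' := (h (k + 1)).2.2.2.1
    rw [hs1] at hin'
    rcases Nat.even_or_odd' (T k) with ⟨m, hm | hm⟩
    · rw [hm, inStrip_even] at hin
      rw [hm, show 2 * n - 1 - (2 * m + 1) = 2 * (n - 1 - m) by omega, inStrip_even,
        show ((n - 1 - m : ℕ) : ℤ) + 1 = n - m by omega, R.Y_sub] at hin'
      have e := R.potential_reflect (m := n - 1 - m) (by omega)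
      rw [show 2 * n - 1 - 2 * (n - 1 - m) = 2 * m + 1 by omega,
        show ((n - 1 - m : ℕ) : ℤ) + 1 = n - m by omega, R.Y_sub,
        show ((n - 1 - m : ℕ) : ℤ) = n - (m + 1) by omega, R.Y_sub] at e
      rw [hm, show 2 * n - 1 - (2 * m + 1) = 2 * (n - 1 - m) by omega] at hs2
      refine ⟨n - (m + 1), ?_, ?_, ?_, ?_, ?_⟩
      · rw [← hw', hm, ← snakeLift_cast, snakeLift_odd]
      · rw [show (n : ℤ) - (m + 1) + 1 = n - m by ring, R.Y_sub]; linarith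
      · rw [R.Y_sub]; linarith
      · rw [show (n : ℤ) - (m + 1) + 1 = n - m by ring, R.Y_sub, R.Y_sub]; linarith
      · have ha : w (k + 1) = ((n - (m + 1) : ℕ) : ZMod n) := by
          rw [← hw', hm, ← snakeLift_cast, snakeLift_odd, Nat.cast_sub (by omega)]; push_cast; rfl
        rw [groupLetter, if_pos, permSlant_apply, ← hw, ← hw', hm, snake_even, snake_odd]
        · ring
        · rw [ha, ZMod.val_natCast_of_lt (by omega)]
          -- In the other case of `groupLetter` the side would be in the window where `Y` decreases,
          -- against the order of the ends of the slot just found.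
          by_contra hc
          have hlt := R.lt
          have := R.antitone (-(m + 1)) (by omega) (by omega)
          rw [show -((m : ℤ) + 1) + 1 = -m by ring] at this
          linarith
    · rw [hm, inStrip_odd] at hin
      rw [hm, show 2 * n - 1 - (2 * m + 1 + 1) = 2 * (n - 2 - m) + 1 by omega, inStrip_odd,
        show (-(((n - 2 - m : ℕ) : ℤ) + 1)) = m + 1 - n by omega] at hin'
      have e := R.potential_reflect (m := m + 1) (by omega)
      have e1 := R.antiY (m + 1 - n)
      rw [sub_add_cancel] at e1
      rw [hm, show 2 * m + 1 + 1 = 2 * (m + 1) by ring] at hs2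
      have e2 := R.antiY (m + 1)
      have e3 := R.antiY (m + 1 + 1)
      push_cast at e
      -- Here `y` lies between `Y (m + 1)` and `Y (m + 2)`, so `-y` lies in the slot of the opposite
      -- side, whose number is larger by `n`.
      refine ⟨m + 1 + n, ?_, ?_, ?_, ?_, ?_⟩
      · rw [← hw', hm, show 2 * m + 1 + 1 = 2 * (m + 1) by ring, snake_even]; push_cast; simp
      · rw [show (m : ℤ) + 1 + n + 1 = m + 1 + 1 + n by ring]; linarith
      · rw [e2]; linarith
      · rw [show (m : ℤ) + 1 + n + 1 = m + 1 + 1 + n by ring]; linarith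
      · have ha : w (k + 1) = ((m + 1 : ℕ) : ZMod n) := by
          rw [← hw', hm, show 2 * m + 1 + 1 = 2 * (m + 1) by ring, snake_even]
        rw [groupLetter, if_neg, permHor_apply, ha, ← hw, hm, snake_odd]
        · push_cast; ring
        · rw [ha, ZMod.val_natCast_of_lt (by omega)]
          intro hc
          have := R.antitone (m + 1) (by omega) (by omega)
          linarith
  refine ⟨?_, ?_, ?_, ?_⟩
  · rw [mem_admissibleIn_zero]
    intro k
    rw [← (h k).2.1, ← (h k).2.2.1]
    exact edge0_snake (h k).1
  · intro k' L hL
    obtain ⟨k, rfl⟩ : ∃ k, k' = k + 1 := ⟨k' - 1, by ring⟩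
    obtain ⟨B, -, -, -, -, hL'⟩ := slot k ⟨L, hL⟩
    rw [← hL.1, add_sub_cancel_right, hL']
  · intro k
    -- Without a sandwiched letter the path would advance by `2n` steps on a snake with only `2n`
    -- places.
    by_contra! hc
    have : ∀ i : ℕ, i ≤ 2 * n → T (k + i) = T k + i := by
      intro i
      induction i with
      | zero => simp
      | succ i ih =>
        intro hi
        have hi' : (i : ℤ) + 1 ≤ 2 * n := by exact_mod_cast hi
        have := not_sand (k + i) (hc _ (by omega) (by omega))
        push_cast
        rw [← add_assoc, this.1, ih (by omega)]; ring
    have h1 := this (2 * n) le_rfl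
    have h2 := (h (k + (2 * n : ℕ))).1
    omega
  · rintro v ⟨f, hf, hr, hv⟩
    have hsand : ∀ m, Sandwiched w (f m) := fun m => by
      have : f m ∈ Set.range f := ⟨m, rfl⟩
      rwa [hr] at this
    choose B hB using fun m => slot (f m - 1) (by rw [sub_add_cancel]; exact hsand m)
    simp only [sub_add_cancel] at hB
    have const : ∀ m, y (f (m + 1) - 1) = y (f m) := by
      intro m
      have key : ∀ k, f m ≤ k → k < f (m + 1) → y k = y (f m) := by
        intro k hk
        induction k, hk using Int.leInduction with
        | base => intro _; rfl
        | succ k hk ih =>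
          intro hlt
          rw [(not_sand k ?_).2, ih (by omega)]
          intro hs
          have : k + 1 ∈ Set.range f := by rw [hr]; exact hs
          obtain ⟨m', hm'⟩ := this
          have a1 := hf.lt_iff_lt.1 (show f m < f m' by omega)
          have a2 := hf.lt_iff_lt.1 (show f m' < f (m + 1) by omega)
          omega
      have := hf (show m < m + 1 by omega)
      exact key _ (by omega) (by omega)
    -- The derived orbit is `-y` just before each sandwiched letter, as `y` jumps only at these
    -- letters.
    refine ⟨fun m => -y (f m - 1), B, fun m => ?_⟩
    obtain ⟨h1, h2, h3, h4, -⟩ := hB m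
    exact ⟨by rw [h1, hv], h2, h3, by simp only [const]; exact h4⟩

end Renormalization

/-! ### Generation: from the exchange `Y` back to the exchange `X` -/

namespace Renormalization

variable {n l : ℕ} {X Y : ℤ → ℝ}

/-- `Y` increases up to `-l`, decreases from `-l` to `n - l` and increases again over one more
window. Along the stretch the indices of the ends of the strips stay on these branches between the
indices given by `a` and `b`, so the bounds at the two ends of the stretch propagate to all its
places. -/
theorem inStrip_of_slots (R : Renormalization n l X Y) {a b : ℤ} (ha : -(l : ℤ) ≤ a)
    (ha' : a < -l + n) (hb : -(l : ℤ) ≤ b) (hb' : b < -l + n) {y : ℝ} (h1 : Y (a + 1) < y)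
    (h2 : y < Y a) (h3 : -Y b < y) (h4 : y < -Y (b + 1)) {s t : ℕ}
    (hs : 0 ≤ a ∧ (s : ℤ) = 2 * a ∨ a < 0 ∧ (s : ℤ) = -2 * a - 1)
    (ht : 0 ≤ b ∧ (t : ℤ) = 2 * b ∨ b < 0 ∧ (t : ℤ) = -2 * b - 1) :
    s < 2 * n - 1 - t ∧ ∀ r, s ≤ r → r < 2 * n - 1 - t → InStrip Y r y := by
  have hl := R.lt
  have e1 := R.antiY b
  have e2 := R.antiY (b + 1)
  have e3 := R.antiY (b + 1 - n)
  have e4 := R.antiY (b - n)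
  rw [sub_add_cancel] at e3 e4
  refine ⟨?_, fun r hr1 hr2 => ⟨?_, ?_⟩⟩
  -- An end place before the start place would order the values of `Y` against the inequalities for
  -- `X`, transported by `even` and `odd`; in the mixed cases the windows of `a` and `b` already
  -- exclude it.
  · by_contra hc
    rcases hs with ⟨hs0, hs⟩ | ⟨hs0, hs⟩ <;> rcases ht with ⟨ht0, ht⟩ | ⟨ht0, ht⟩
    · have i1 := R.antitone_of_le (a := n - b) (b := a) (by omega) (by omega) (by omega)
      have i2 := R.even (n - b)
      have i3 := R.neg_le (n - b) (by omega) (by omega)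
      rw [neg_sub] at i2 i3
      linarith
    · omega
    · omega
    · have i1 := R.monotone_of_le (a := b + 1 + n) (b := -a) (by omega) (by omega) (by omega)
      have i2 := R.odd (-a)
      have i3 := R.le_one_sub (-a) (by omega) (by omega)
      rw [sub_neg_eq_add, add_comm] at i2 i3
      linarith
  · rcases le_or_gt ((r + 2) / 2) (n - l) with hi | hi
    · have := R.antitone_of_le (a := a + 1) (b := ((r + 2) / 2 : ℕ)) (by omega) (by omega) (by omega)
      linarith
    · have := R.monotone_of_le (a := ((r + 2) / 2 : ℕ)) (b := b + n) (by omega) (by omega) (by omega)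
      linarith
  · rcases le_or_gt ((r + 1) / 2) l with hi | hi
    · have := R.antitone_of_le (a := -((r + 1) / 2 : ℕ)) (b := a) (by omega) (by omega) (by omega)
      linarith
    · have := R.monotone_of_le' (a := b + 1 - n) (b := -((r + 1) / 2 : ℕ)) (by omega) (by omega)
        (by omega)
      linarith

/-- A word coded by `Y` generates a word coded by `X`. -/
theorem generate [NeZero n] (R : Renormalization n l X Y) {v : Word n} (h : IsCoded n Y v) :
    (∀ m, startPlace n l (v m) < 2 * n - 1 - startPlace n l (v (m + 1))) ∧
    ∀ f : ℤ → ℤ, (∀ m, f (m + 1) = f m +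
        ((2 * n - 1 - startPlace n l (v (m + 1)) - startPlace n l (v m) : ℕ) : ℤ)) →
      ∃ W, IsCoded n X W ∧
        ∀ (m : ℤ) (r : ℕ), f m + r < f (m + 1) → W (f m + r) = snake n (startPlace n l (v m) + r) := by
  obtain ⟨Z, B, hB, h⟩ := h.exists_lift_mem R.pos R.antiY R.antitone
  -- In the window `-l ≤ B m < n - l` the nonnegative lifts are the letters of the first case of
  -- `groupLetter`, and the negative lifts those of the second.
  have hs : ∀ m, 0 ≤ B m ∧ (startPlace n l (v m) : ℤ) = 2 * B m ∨
      B m < 0 ∧ (startPlace n l (v m) : ℤ) = -2 * B m - 1 := by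
    intro m
    have hlt := (v m).val_lt
    have hl := R.lt
    have h0 := hB m
    have hd : (n : ℤ) ∣ B m - (v m).val := by
      rw [← ZMod.intCast_eq_intCast_iff_dvd_sub, (h m).1]; simp
    obtain ⟨q, hq⟩ := hd
    have hn' : (0 : ℤ) < n := by exact_mod_cast R.pos
    have hq1 : q < 1 := by
      by_contra hc
      have : (n : ℤ) * 1 ≤ n * q := mul_le_mul_of_nonneg_left (by omega) hn'.le
      omega
    have hq2 : -2 < q := by
      by_contra hc
      have : (n : ℤ) * q ≤ n * (-2) := mul_le_mul_of_nonneg_left (by omega) hn'.le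
      omega
    unfold startPlace
    obtain rfl | rfl : q = 0 ∨ q = -1 := by omega
    · left; rw [if_pos (by omega)]; push_cast; omega
    · right; rw [if_neg (by omega)]; omega
  have hstart : ∀ m, Y (B m + 1) < -Z (m + 1) ∧ -Z (m + 1) < Y (B m) := by
    intro m
    obtain ⟨-, h1, h2, h3⟩ := h m
    constructor <;> linarith
  have strip := fun m => R.inStrip_of_slots (hB m).1 (hB m).2 (hB (m + 1)).1 (hB (m + 1)).2
    (hstart m).1 (hstart m).2 (neg_lt_neg (h (m + 1)).2.2.1) (neg_lt_neg (h (m + 1)).2.1)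
    (hs m) (hs (m + 1))
  obtain ⟨s, hsdef⟩ : ∃ s : ℤ → ℕ, ∀ m, startPlace n l (v m) = s m := ⟨_, fun _ => rfl⟩
  simp only [hsdef] at hs strip ⊢
  refine ⟨fun m => (strip m).1, fun f hf => ?_⟩
  have hmono : StrictMono f := by
    refine strictMono_int_of_lt_succ fun m => ?_
    have := (strip m).1
    have := hf m
    omega
  -- Between the letters `m` and `m + 1` the strip coordinate is constantly `-Z (m + 1)` and the
  -- place advances from `s m`; subtracting the potential gives the orbit of `X`.
  obtain ⟨D, hD⟩ := exists_concat hmono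
    fun m r => (-Z (m + 1) - potential X Y (s m + r), snakeLift n (s m + r))
  refine ⟨fun k => ((D k).2 : ZMod n), ⟨fun k => (D k).1, fun k => (D k).2, fun k => ⟨rfl, ?_⟩⟩, ?_⟩
  · obtain ⟨m, hm1, hm2⟩ := exists_le_lt_of_strictMono hmono k
    obtain ⟨r, rfl⟩ : ∃ r : ℕ, k = f m + r := ⟨(k - f m).toNat, by omega⟩
    have hfm := hf m
    have hst := (strip m).1
    have hslot := R.slot_of_inStrip (t := s m + r) (by omega)
      ((strip m).2 (s m + r) (by omega) (by omega))
    have hsucc := R.potential_succ (s m + r)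
    beta_reduce
    rw [hD m r hm2]
    refine ⟨hslot.1, hslot.2, ?_⟩
    -- Inside a stretch a step is `potential_succ`. The last step also jumps from the place `2n - 1
    -- - s (m + 1)` to `s (m + 1)`, which by `potential_reflect` is one step of the orbit `Z`.
    rcases lt_or_ge (f m + r + 1) (f (m + 1)) with hlt | hge
    · have := hD m (r + 1) (by push_cast; omega)
      push_cast at this
      rw [add_assoc, this, ← add_assoc, hsucc]
      ring
    · have h0 := hD (m + 1) 0 (by have := hmono (show m + 1 < m + 1 + 1 by omega); simpa using this)
      rw [Nat.cast_zero, add_zero] at h0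
      rw [show f m + r + 1 = f (m + 1) by omega, h0]
      have hend : s m + r + 1 = 2 * n - 1 - s (m + 1) := by omega
      rw [hend] at hsucc
      obtain ⟨-, -, -, h3⟩ := h (m + 1)
      have hl := R.lt
      have hBm := hB (m + 1)
      simp only [add_zero]
      rcases hs (m + 1) with ⟨h0, h1⟩ | ⟨h0, h1⟩
      · obtain ⟨M, hM⟩ : ∃ M : ℕ, B (m + 1) = M := ⟨(B (m + 1)).toNat, by omega⟩
        have hr := R.potential_reflect (m := M) (by omega)
        rw [show 2 * M = s (m + 1) by omega, ← hM] at hr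
        linarith
      · obtain ⟨M, hM⟩ : ∃ M : ℕ, B (m + 1) + n = M := ⟨(B (m + 1) + n).toNat, by omega⟩
        have hr := R.potential_reflect (m := M) (by omega)
        have e1 := R.antiY (B (m + 1))
        have e2 := R.antiY (B (m + 1) + 1)
        rw [show 2 * n - 1 - 2 * M = s (m + 1) by omega,
          show 2 * M = 2 * n - 1 - s (m + 1) by omega, ← hM,
          show B (m + 1) + n + 1 = B (m + 1) + 1 + n by ring] at hr
        linarith
  · intro m r hr
    simp only [hD m r hr, snakeLift_cast]

end Renormalization
open Real

/-! ### Directions and sectors -/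

/-- Half the angle between consecutive sides. -/
noncomputable def halfAngle (n : ℕ) : ℝ := π / (2 * n)

/-- The coordinate, transversally to the direction `(u, v)`, of the vertex between the sides `a - 1`
and `a` of a `2n`-gon with circumradius `1`. -/
noncomputable def vertexCoord (n : ℕ) (u v : ℝ) (a : ℤ) : ℝ :=
  u * cos ((2 * a - 1) * halfAngle n) - v * sin ((2 * a - 1) * halfAngle n)

/-- The position of the direction `(u, v)` relatively to the direction of angle `π i / 2n`. -/
noncomputable def wedge (n : ℕ) (u v : ℝ) (i : ℤ) : ℝ :=
  v * cos (i * halfAngle n) - u * sin (i * halfAngle n)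

/-- The words coded by a direction in the sector `[π i / 2n, π (i + 1) / 2n]`. -/
def sectorWords (n i : ℕ) : Set (Word n) :=
  {w | ∃ u v : ℝ, 0 ≤ wedge n u v i ∧ wedge n u v (i + 1) ≤ 0 ∧ IsCoded n (vertexCoord n u v) w}

section

variable {n : ℕ}

theorem two_mul_halfAngle (hn : 0 < n) : 2 * n * halfAngle n = π := by
  have : (n : ℝ) ≠ 0 := by positivity
  rw [halfAngle]; field_simp

theorem sin_halfAngle_pos (hn : 1 < n) : 0 < sin (halfAngle n) := by
  have h := two_mul_halfAngle (n := n) (by omega)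
  have hn' : (1 : ℝ) < n := by exact_mod_cast hn
  have h0 : 0 < halfAngle n := by unfold halfAngle; positivity
  apply sin_pos_of_pos_of_lt_pi h0
  nlinarith

theorem cos_halfAngle_pos (hn : 1 < n) : 0 < cos (halfAngle n) := by
  have h := two_mul_halfAngle (n := n) (by omega)
  have hn' : (1 : ℝ) < n := by exact_mod_cast hn
  have h0 : 0 < halfAngle n := by unfold halfAngle; positivity
  apply cos_pos_of_mem_Ioo
  constructor <;> nlinarith

theorem sin_mul_halfAngle_nonneg (hn : 0 < n) {i : ℤ} (h0 : 0 ≤ i) (h : i ≤ 2 * n) :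
    0 ≤ sin (i * halfAngle n) := by
  have e := two_mul_halfAngle hn
  have hp : 0 < halfAngle n := by unfold halfAngle; positivity
  have h0' : (0 : ℝ) ≤ i := by exact_mod_cast h0
  have h' : (i : ℝ) ≤ 2 * n := by exact_mod_cast h
  apply sin_nonneg_of_nonneg_of_le_pi (by positivity)
  nlinarith

theorem sin_mul_halfAngle_pos (hn : 0 < n) {i : ℤ} (h0 : 0 < i) (h : i < 2 * n) :
    0 < sin (i * halfAngle n) := by
  have e := two_mul_halfAngle hn
  have hp : 0 < halfAngle n := by unfold halfAngle; positivity
  have h0' : (0 : ℝ) < i := by exact_mod_cast h0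
  have h' : (i : ℝ) < 2 * n := by exact_mod_cast h
  apply sin_pos_of_pos_of_lt_pi (by positivity)
  nlinarith

theorem wedge_antiperiodic (hn : 0 < n) (u v : ℝ) : Function.Antiperiodic (wedge n u v) (2 * n) := by
  intro i
  have e := two_mul_halfAngle hn
  simp only [wedge]
  push_cast
  rw [add_mul, e, cos_add_pi, sin_add_pi]; ring

theorem vertexCoord_antiperiodic (hn : 0 < n) (u v : ℝ) :
    Function.Antiperiodic (vertexCoord n u v) n := by
  intro a
  have e := two_mul_halfAngle hn
  simp only [vertexCoord]
  push_cast
  rw [show (2 * ((a : ℝ) + n) - 1) * halfAngle n = (2 * a - 1) * halfAngle n + 2 * n * halfAngle n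
    by ring, e, cos_add_pi, sin_add_pi]; ring

theorem vertexCoord_sub_succ (u v : ℝ) (a : ℤ) :
    vertexCoord n u v a - vertexCoord n u v (a + 1) =
      2 * sin (halfAngle n) * wedge n u v (-2 * a) := by
  simp only [vertexCoord, wedge]
  push_cast
  rw [show (2 * (a : ℝ) - 1) * halfAngle n = 2 * a * halfAngle n - halfAngle n by ring,
    show (2 * ((a : ℝ) + 1) - 1) * halfAngle n = 2 * a * halfAngle n + halfAngle n by ring,
    show -2 * (a : ℝ) * halfAngle n = -(2 * a * halfAngle n) by ring,
    cos_sub, sin_sub, cos_add, sin_add, cos_neg, sin_neg]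
  ring

theorem vertexCoord_sub_neg (u v : ℝ) (m : ℤ) :
    vertexCoord n u v m - vertexCoord n u v (-m) =
      -2 * sin ((2 * m : ℤ) * halfAngle n) * wedge n u v 1 := by
  simp only [vertexCoord, wedge]
  push_cast
  rw [show (2 * (m : ℝ) - 1) * halfAngle n = 2 * m * halfAngle n - halfAngle n by ring,
    show (2 * (-(m : ℝ)) - 1) * halfAngle n = -(2 * m * halfAngle n + halfAngle n) by ring, one_mul,
    cos_neg, sin_neg, cos_sub, sin_sub, cos_add, sin_add]
  ring

theorem vertexCoord_one_sub_sub (u v : ℝ) (m : ℤ) :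
    vertexCoord n u v (1 - m) - vertexCoord n u v m =
      2 * sin ((2 * m - 1 : ℤ) * halfAngle n) * wedge n u v 0 := by
  simp only [vertexCoord, wedge]
  push_cast
  rw [show (2 * (1 - (m : ℝ)) - 1) * halfAngle n = -((2 * m - 1) * halfAngle n) by ring,
    cos_neg, sin_neg]
  simp
  ring

/-- By the addition formulas, `wedge` at `i` is a combination of its values at `j` and `j + 1` with
coefficients of signs `+` and `-`: for `i` in this range both sines have their argument in `[0, π]`.
-/
theorem wedge_nonneg (hn : 1 < n) {u v : ℝ} {j : ℤ} (h : 0 ≤ wedge n u v j)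
    (h' : wedge n u v (j + 1) ≤ 0) {i : ℤ} (hi : j + 1 - 2 * n ≤ i) (hij : i ≤ j) :
    0 ≤ wedge n u v i := by
  have key : wedge n u v i * sin (halfAngle n) =
      wedge n u v j * sin ((j + 1 - i : ℤ) * halfAngle n) -
        wedge n u v (j + 1) * sin ((j - i : ℤ) * halfAngle n) := by
    have p1 := sin_sq_add_cos_sq (j * halfAngle n)
    simp only [wedge]
    push_cast
    simp only [add_mul, sub_mul, one_mul, cos_add, sin_add, sin_sub]
    linear_combination (v * cos (i * halfAngle n) * sin (halfAngle n) -
      u * sin (i * halfAngle n) * sin (halfAngle n)) * (-p1)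
  have s1 := sin_mul_halfAngle_nonneg (n := n) (i := j + 1 - i) (by omega) (by omega) (by omega)
  have s2 := sin_mul_halfAngle_nonneg (n := n) (i := j - i) (by omega) (by omega) (by omega)
  have s3 := sin_halfAngle_pos hn
  refine nonneg_of_mul_nonneg_left (b := sin (halfAngle n)) ?_ s3
  rw [key]
  nlinarith [mul_nonneg h s1, mul_nonneg (neg_nonneg.2 h') s2]

/-- A discrete intermediate value argument. The strict alternative in `h1` is the one the induction
passes on; it excludes `a = b`. -/
theorem exists_sector {u v : ℝ} {a b : ℕ} (hab : a ≤ b) (h0 : 0 ≤ wedge n u v a)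
    (h1 : wedge n u v b < 0 ∨ a < b ∧ wedge n u v b ≤ 0) :
    ∃ j : ℕ, a ≤ j ∧ j < b ∧ 0 ≤ wedge n u v j ∧ wedge n u v (j + 1) ≤ 0 := by
  induction b, hab using Nat.le_induction with
  | base => rcases h1 with h1 | h1 <;> [linarith; omega]
  | succ b hb ih =>
    rcases le_or_gt 0 (wedge n u v b) with h | h
    · refine ⟨b, hb, by omega, h, ?_⟩
      push_cast at h1
      rcases h1 with h1 | h1
      · exact h1.le
      · exact h1.2
    · obtain ⟨j, hj1, hj2, hj⟩ := ih (Or.inl h)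
      exact ⟨j, hj1, by omega, hj⟩

/-- `huv` says that `(u', v)` is the image of `(u, v)` under the Veech involution, cleared of
denominators. For `a` in the window from `-(j / 2)` the index `-2 * a` lies between `j + 1 - 2n` and
`j`, which is the range of `wedge_nonneg`; this is why the group is `j / 2`. -/
theorem renormalization_of_wedge (hn : 1 < n) {u u' v : ℝ} {j : ℕ} (hj : j < 2 * n)
    (huv : sin (halfAngle n) * (u + u') = 2 * cos (halfAngle n) * v)
    (h0 : 0 ≤ wedge n u v 0) (h1 : wedge n u v 1 ≤ 0) (hj0 : 0 ≤ wedge n u' v j)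
    (hj1 : wedge n u' v (j + 1) ≤ 0) :
    Renormalization n (j / 2) (vertexCoord n u v) (vertexCoord n u' v) where
  lt := by omega
  antiX := vertexCoord_antiperiodic (by omega) u v
  antiY := vertexCoord_antiperiodic (by omega) u' v
  even m := by
    have hs := sin_halfAngle_pos hn
    apply mul_left_cancel₀ hs.ne'
    simp only [vertexCoord]
    push_cast
    rw [show (2 * (m : ℝ) - 1) * halfAngle n = 2 * m * halfAngle n - halfAngle n by ring,
      show (2 * (-(m : ℝ)) - 1) * halfAngle n = -(2 * m * halfAngle n + halfAngle n) by ring,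
      cos_neg, sin_neg, cos_sub, sin_sub, cos_add, sin_add]
    linear_combination (2 * sin (2 * m * halfAngle n) * sin (halfAngle n)) * huv
  odd m := by
    simp only [vertexCoord]
    push_cast
    rw [show (2 * (1 - (m : ℝ)) - 1) * halfAngle n = -((2 * m - 1) * halfAngle n) by ring,
      cos_neg, sin_neg]
    ring
  neg_le m h2 h3 := by
    have e := vertexCoord_sub_neg (n := n) u v m
    have s := sin_mul_halfAngle_nonneg (n := n) (i := 2 * m) (by omega) (by omega) (by omega)
    nlinarith
  le_one_sub m h2 h3 := by
    have e := vertexCoord_one_sub_sub (n := n) u v m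
    have s := sin_mul_halfAngle_nonneg (n := n) (i := 2 * m - 1) (by omega) (by omega) (by omega)
    nlinarith
  antitone a h2 h3 := by
    have e := vertexCoord_sub_succ (n := n) u' v a
    have s := sin_halfAngle_pos hn
    have := wedge_nonneg hn hj0 hj1 (i := -2 * a) (by omega) (by omega)
    have := mul_nonneg s.le this
    linarith

theorem wedge_zero (u v : ℝ) : wedge n u v 0 = v := by simp [wedge]

theorem wedge_one (u v : ℝ) :
    wedge n u v 1 = v * cos (halfAngle n) - u * sin (halfAngle n) := by simp [wedge]

/-- The directions in the sector `[0, π / 2n]` renormalize to directions in `[π / 2n, π]`. -/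
theorem exists_renormalization (hn : 1 < n) {u v : ℝ} (h0 : 0 ≤ wedge n u v 0)
    (h1 : wedge n u v 1 ≤ 0) : ∃ (j : ℕ) (u' v' : ℝ), 1 ≤ j ∧ j < 2 * n ∧ 0 ≤ wedge n u' v' j ∧
      wedge n u' v' (j + 1) ≤ 0 ∧
      Renormalization n (j / 2) (vertexCoord n u v) (vertexCoord n u' v') := by
  have hs := sin_halfAngle_pos hn
  set u' := -u + 2 * cos (halfAngle n) * v / sin (halfAngle n) with hu'
  have huv : sin (halfAngle n) * (u + u') = 2 * cos (halfAngle n) * v := by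
    rw [hu']; field_simp; ring
  -- The involution keeps `v` and changes the sign of `wedge` at `1`, so it carries the sector `[0,
  -- π / 2n]` into `[π / 2n, π]`.
  have a1 : 0 ≤ wedge n u' v (1 : ℕ) := by
    rw [wedge_one] at h1
    push_cast
    rw [wedge_one]
    linarith
  have a2 : wedge n u' v (2 * n : ℕ) ≤ 0 := by
    have := wedge_antiperiodic (n := n) (by omega) u' v 0
    push_cast
    rw [zero_add, wedge_zero] at this
    rw [wedge_zero] at h0
    linarith
  obtain ⟨j, hj1, hj2, hj3, hj4⟩ := exists_sector (by omega) a1 (Or.inr ⟨by omega, a2⟩)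
  exact ⟨j, u', v, hj1, hj2, hj3, hj4, renormalization_of_wedge hn hj2 huv h0 h1 hj3 hj4⟩

theorem exists_renormalization_inv (hn : 1 < n) {j : ℕ} (hj : 1 ≤ j) (hj' : j < 2 * n) {u' v' : ℝ}
    (h0 : 0 ≤ wedge n u' v' j) (h1 : wedge n u' v' (j + 1) ≤ 0) :
    ∃ u v : ℝ, 0 ≤ wedge n u v 0 ∧ wedge n u v 1 ≤ 0 ∧
      Renormalization n (j / 2) (vertexCoord n u v) (vertexCoord n u' v') := by
  have hs := sin_halfAngle_pos hn
  set u := -u' + 2 * cos (halfAngle n) * v' / sin (halfAngle n) with hu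
  have huv : sin (halfAngle n) * (u + u') = 2 * cos (halfAngle n) * v' := by
    rw [hu]; field_simp; ring
  have a0 := wedge_nonneg hn h0 h1 (i := 0) (by omega) (by omega)
  have a1 := wedge_nonneg hn h0 h1 (i := 1) (by omega) (by omega)
  have b0 : 0 ≤ wedge n u v' 0 := by rwa [wedge_zero] at a0 ⊢
  have b1 : wedge n u v' 1 ≤ 0 := by rw [wedge_one] at a1 ⊢; linarith
  exact ⟨u, v', b0, b1, renormalization_of_wedge hn hj' huv b0 b1 h0 h1⟩

/-! ### Symmetries -/

/-- The rotation by `-kπ / n`. -/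
theorem exists_rotate (k : ℤ) (u v : ℝ) : ∃ u' v' : ℝ,
    (∀ i, wedge n u' v' i = wedge n u v (i + 2 * k)) ∧
      ∀ a, vertexCoord n u' v' a = vertexCoord n u v (a - k) := by
  refine ⟨u * cos (2 * k * halfAngle n) + v * sin (2 * k * halfAngle n),
    v * cos (2 * k * halfAngle n) - u * sin (2 * k * halfAngle n), fun i => ?_, fun a => ?_⟩
  · simp only [wedge]
    push_cast
    rw [add_mul (i : ℝ), cos_add, sin_add]
    ring
  · simp only [vertexCoord]
    push_cast
    rw [show (2 * ((a : ℝ) - k) - 1) * halfAngle n = (2 * a - 1) * halfAngle n - 2 * k * halfAngle n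
      by ring, cos_sub, sin_sub]
    ring

/-- The reflection in the line at angle `(k + 1)π / 2n`, which exchanges the sectors `2k + 1` and
`0`. -/
theorem exists_reflect (k : ℤ) (u v : ℝ) : ∃ u' v' : ℝ,
    (∀ i, wedge n u' v' i = -wedge n u v (2 * k + 2 - i)) ∧
      ∀ a, vertexCoord n u' v' a = vertexCoord n u v (-a - k) := by
  refine ⟨u * cos ((2 * k + 2) * halfAngle n) + v * sin ((2 * k + 2) * halfAngle n),
    u * sin ((2 * k + 2) * halfAngle n) - v * cos ((2 * k + 2) * halfAngle n), fun i => ?_,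
    fun a => ?_⟩
  · simp only [wedge]
    push_cast
    rw [sub_mul _ (i : ℝ), cos_sub, sin_sub]
    ring
  · simp only [vertexCoord]
    push_cast
    rw [show (2 * (-(a : ℝ) - k) - 1) * halfAngle n =
      -((2 * a - 1) * halfAngle n + (2 * k + 2) * halfAngle n) by ring, cos_neg, sin_neg, cos_add,
      sin_add]
    ring

theorem IsCoded.rotate {X : ℤ → ℝ} {w : Word n} (h : IsCoded n X w) {c : ℤ}
    {p : Equiv.Perm (ZMod n)} (hp : ∀ a, p a = a + c) :
    IsCoded n (fun a => X (a - c)) (relabel p w) := by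
  obtain ⟨x, A, h⟩ := h
  refine ⟨x, fun k => A k + c, fun k => ?_⟩
  obtain ⟨h1, h2⟩ := h k
  simp only [add_sub_cancel_right, relabel, hp, ← h1, show A k + c + 1 - c = A k + 1 by ring]
  exact ⟨by push_cast; rfl, h2⟩

/-- A reflection reverses the order of the two ends of a side. Negating the coordinate and passing
to the opposite side, by `+ n` in the lift, restores it. -/
theorem IsCoded.reflect {X : ℤ → ℝ} (hX : Function.Antiperiodic X (n : ℤ)) {w : Word n}
    (h : IsCoded n X w) {c : ℤ} {p : Equiv.Perm (ZMod n)} (hp : ∀ a, p a = -a - 1 - c) :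
    IsCoded n (fun a => X (-a - c)) (relabel p w) := by
  obtain ⟨x, A, h⟩ := h
  refine ⟨fun k => -x k, fun k => -A k - 1 - c + n, fun k => ?_⟩
  obtain ⟨h1, h2, h3, h4⟩ := h k
  have e1 := hX (A k - n)
  have e2 := hX (A k + 1 - n)
  rw [sub_add_cancel] at e1 e2
  simp only [relabel, hp, ← h1, show -(-A k - 1 - c + n) - c = A k + 1 - n by ring,
    show -(-A k - 1 - c + n + 1) - c = A k - n by ring]
  exact ⟨by push_cast; simp, by linarith, by linarith, by linarith⟩

theorem mem_sectorWords_iff (hn : 0 < n) {i : ℕ} {w : Word n} :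
    w ∈ sectorWords n i ↔ relabel (perm n i) w ∈ sectorWords n 0 := by
  rcases Nat.even_or_odd' i with ⟨k, rfl | rfl⟩
  · constructor
    · rintro ⟨u, v, h0, h1, h⟩
      obtain ⟨u', v', e1, e2⟩ := exists_rotate (n := n) k u v
      refine ⟨u', v', ?_, ?_, ?_⟩
      · rw [e1]; push_cast at h0 ⊢; rwa [zero_add]
      · rw [e1]; push_cast at h1 ⊢; rwa [add_comm 1]
      · rw [funext e2]
        exact h.rotate fun a => by rw [perm_even]; push_cast; rfl
    · rintro ⟨u, v, h0, h1, h⟩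
      obtain ⟨u', v', e1, e2⟩ := exists_rotate (n := n) (-k) u v
      refine ⟨u', v', ?_, ?_, ?_⟩
      · rw [e1]; push_cast at h0 ⊢; rwa [show 2 * (k : ℤ) + 2 * -k = 0 by ring]
      · rw [e1]; push_cast at h1 ⊢; rwa [show 2 * (k : ℤ) + 1 + 2 * -k = 0 + 1 by ring]
      · rw [funext e2, ← relabel_inv_relabel (perm n (2 * k)) w]
        exact h.rotate fun a => by rw [Equiv.Perm.inv_eq_iff_eq, perm_even]; push_cast; ring
  · constructor
    · rintro ⟨u, v, h0, h1, h⟩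
      obtain ⟨u', v', e1, e2⟩ := exists_reflect (n := n) k u v
      refine ⟨u', v', ?_, ?_, ?_⟩
      · rw [e1]; push_cast at h1 ⊢
        rw [show 2 * (k : ℤ) + 2 - 0 = 2 * k + 1 + 1 by ring]; linarith
      · rw [e1]; push_cast at h0 ⊢
        rw [show 2 * (k : ℤ) + 2 - 1 = 2 * k + 1 by ring]; linarith
      · rw [funext e2]
        exact h.reflect (vertexCoord_antiperiodic hn u v) fun a => by rw [perm_odd]; push_cast; rfl
    · rintro ⟨u, v, h0, h1, h⟩
      obtain ⟨u', v', e1, e2⟩ := exists_reflect (n := n) k u v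
      refine ⟨u', v', ?_, ?_, ?_⟩
      · rw [e1]; push_cast at h1 ⊢
        rw [show 2 * (k : ℤ) + 2 - (2 * k + 1) = 1 by ring]; linarith
      · rw [e1]; push_cast at h0 ⊢
        rw [show 2 * (k : ℤ) + 2 - (2 * k + 1 + 1) = 0 by ring]; linarith
      · rw [funext e2, ← relabel_inv_relabel (perm n (2 * k + 1)) w]
        exact h.reflect (vertexCoord_antiperiodic hn u v) fun a => by
          rw [Equiv.Perm.inv_eq_iff_eq, perm_odd]; push_cast; ring

theorem sectorWords_shift {i : ℕ} {w : Word n} (h : w ∈ sectorWords n i) (s : ℤ) :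
    (fun k => w (k + s)) ∈ sectorWords n i := by
  obtain ⟨u, v, h0, h1, h⟩ := h
  exact ⟨u, v, h0, h1, h.shift s⟩

/-! ### Periodic words -/

/-- The hypotheses say that the exchange carries the slot of `A` onto that of `B`, hence the latter
back onto the former; the two midpoints form an orbit. -/
theorem isCoded_alternating {X : ℤ → ℝ} {A B : ℤ} (hA : X (A + 1) < X A) (h1 : X B = -X (A + 1))
    (h2 : X (B + 1) = -X A) {a b : ZMod n} (ha : (A : ZMod n) = a) (hb : (B : ZMod n) = b) :
    IsCoded n X fun k => if Even k then a else b := by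
  refine ⟨fun k => if Even k then (X A + X (A + 1)) / 2 else (X B + X (B + 1)) / 2,
    fun k => if Even k then A else B, fun k => ?_⟩
  by_cases hk : Even k
  · simp only [hk, if_true, Int.even_add_one, not_true, if_false]
    exact ⟨ha, by linarith, by linarith, by linarith⟩
  · simp only [hk, if_false, Int.even_add_one, not_false_iff, if_true]
    exact ⟨hb, by linarith, by linarith, by linarith⟩

/-- In the two directions bounding the sector the surface splits into cylinders. Edges with `a.val +
b.val + 1 = n` come from the direction `π / 2n`, where `X` is even, and those with `a.val + b.val =
n` from the direction `0`, where `X` is symmetric about `1 / 2`. -/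
theorem alternating_mem_sectorWords [NeZero n] (hn : 1 < n) {a b : ZMod n} (h : Edge0 n a b) :
    (fun k : ℤ => if Even k then a else b) ∈ sectorWords n 0 := by
  have ha := a.val_lt
  have hb := b.val_lt
  have hs := sin_halfAngle_pos hn
  have hc := cos_halfAngle_pos hn
  have cast : ∀ c : ZMod n, ((c.val : ℤ) : ZMod n) = c := fun c => by simp
  rcases h with h | h
  · have hw1 : wedge n (cos (halfAngle n)) (sin (halfAngle n)) 1 = 0 := by rw [wedge_one]; ring
    refine ⟨cos (halfAngle n), sin (halfAngle n), ?_, ?_, ?_⟩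
    · rw [Nat.cast_zero, wedge_zero]; exact hs.le
    · rw [Nat.cast_zero, zero_add, hw1]
    have e : ∀ m, vertexCoord n (cos (halfAngle n)) (sin (halfAngle n)) m =
        vertexCoord n (cos (halfAngle n)) (sin (halfAngle n)) (-m) := by
      intro m
      have := vertexCoord_sub_neg (n := n) (cos (halfAngle n)) (sin (halfAngle n)) m
      rw [hw1] at this
      linarith
    have hX := vertexCoord_antiperiodic (n := n) (by omega) (cos (halfAngle n)) (sin (halfAngle n))
    refine isCoded_alternating (A := a.val) (B := b.val) ?_ ?_ ?_ (cast a) (cast b)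
    · have hsub := vertexCoord_sub_succ (n := n) (cos (halfAngle n)) (sin (halfAngle n)) a.val
      have hw : wedge n (cos (halfAngle n)) (sin (halfAngle n)) (-2 * a.val) =
          sin ((2 * a.val + 1 : ℤ) * halfAngle n) := by
        rw [wedge]; push_cast
        rw [add_mul, sin_add, show -2 * (a.val : ℝ) * halfAngle n = -(2 * a.val * halfAngle n) by ring,
          cos_neg, sin_neg, one_mul]; ring
      have := sin_mul_halfAngle_pos (n := n) (i := 2 * a.val + 1) (by omega) (by omega) (by omega)
      have := mul_pos hs this
      rw [hw] at hsub
      linarith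
    · rw [show (b.val : ℤ) = n - (a.val + 1) by omega, antiperiodic_natCast_sub hX, ← e]
    · rw [show (b.val : ℤ) + 1 = n - a.val by omega, antiperiodic_natCast_sub hX, ← e]
  · refine ⟨1, 0, ?_, ?_, ?_⟩
    · rw [Nat.cast_zero, wedge_zero]
    · rw [Nat.cast_zero, zero_add, wedge_one]; linarith
    have e : ∀ m, vertexCoord n 1 0 (1 - m) = vertexCoord n 1 0 m := by
      intro m
      have := vertexCoord_one_sub_sub (n := n) 1 0 m
      rw [wedge_zero] at this
      linarith
    have hX := vertexCoord_antiperiodic (n := n) (by omega) 1 0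
    refine isCoded_alternating (A := a.val) (B := b.val) ?_ ?_ ?_ (cast a) (cast b)
    · have hsub := vertexCoord_sub_succ (n := n) 1 0 a.val
      have hw : wedge n 1 0 (-2 * a.val) = sin ((2 * a.val : ℤ) * halfAngle n) := by
        rw [wedge]; push_cast
        rw [show -2 * (a.val : ℝ) * halfAngle n = -(2 * a.val * halfAngle n) by ring, sin_neg]; ring
      have := sin_mul_halfAngle_pos (n := n) (i := 2 * a.val) (by omega) (by omega) (by omega)
      have := mul_pos hs this
      rw [hw] at hsub
      linarith
    · rw [show (b.val : ℤ) = n - a.val by omega, antiperiodic_natCast_sub hX, ← e (a.val + 1)]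
      congr 2; ring
    · rw [show (b.val : ℤ) + 1 = n - (a.val - 1) by omega, antiperiodic_natCast_sub hX, ← e a.val]
      congr 2; ring

/-- The derived word of a word of the sector `[0, π / 2n]`. -/
theorem derive_sectorWords [NeZero n] (hn : 3 ≤ n) {w : Word n} (h : w ∈ sectorWords n 0) :
    w ∈ admissibleIn n 0 ∧ (∀ k : ℤ, ∃ k', k < k' ∧ k' ≤ k + 2 * n ∧ Sandwiched w k') ∧
      ∃ j, 1 ≤ j ∧ j < 2 * n ∧ InGroup n (j / 2) w ∧ ∀ v, IsDerived w v → v ∈ sectorWords n j := by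
  obtain ⟨u, v, h0, h1, h⟩ := h
  obtain ⟨j, u', v', hj, hj', h0', h1', R⟩ := exists_renormalization (by omega) h0 (by simpa using h1)
  obtain ⟨a, b, c, d⟩ := R.derive hn h
  exact ⟨a, c, j, hj, hj', b, fun v hv => ⟨u', v', h0', h1', d v hv⟩⟩

theorem generate_sectorWords [NeZero n] (hn : 1 < n) {j : ℕ} (hj : 1 ≤ j) (hj' : j < 2 * n)
    {v : Word n} (h : v ∈ sectorWords n j) :
    (∀ m, startPlace n (j / 2) (v m) < 2 * n - 1 - startPlace n (j / 2) (v (m + 1))) ∧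
    ∀ f : ℤ → ℤ, (∀ m, f (m + 1) = f m + ((2 * n - 1 - startPlace n (j / 2) (v (m + 1)) -
        startPlace n (j / 2) (v m) : ℕ) : ℤ)) →
      ∃ W ∈ sectorWords n 0, ∀ (m : ℤ) (r : ℕ), f m + r < f (m + 1) →
        W (f m + r) = snake n (startPlace n (j / 2) (v m) + r) := by
  obtain ⟨u', v', h0', h1', h⟩ := h
  obtain ⟨u, v, h0, h1, R⟩ := exists_renormalization_inv hn hj hj' h0' h1'
  obtain ⟨a, b⟩ := R.generate h
  refine ⟨a, fun f hf => ?_⟩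
  obtain ⟨W, hW, hW'⟩ := b f hf
  exact ⟨W, ⟨u, v, h0, by simpa using h1, hW⟩, hW'⟩

end

/-! ### Derived words -/

theorem exists_strictMono_range_eq {P : ℤ → Prop} (h1 : ∀ k, ∃ k', k < k' ∧ P k')
    (h2 : ∀ k, ∃ k', k' < k ∧ P k') : ∃ f : ℤ → ℤ, StrictMono f ∧ Set.range f = {m | P m} := by
  classical
  let S := {m : ℤ // P m}
  have : Nonempty S := ⟨⟨_, (h1 0).choose_spec.2⟩⟩
  have : NoMaxOrder S := ⟨fun a => ⟨⟨_, (h1 a).choose_spec.2⟩, (h1 a).choose_spec.1⟩⟩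
  have : NoMinOrder S := ⟨fun a => ⟨⟨_, (h2 a).choose_spec.2⟩, (h2 a).choose_spec.1⟩⟩
  let : LocallyFiniteOrder S := Subtype.instLocallyFiniteOrder P
  let : SuccOrder S := LinearLocallyFiniteOrder.succOrder S
  let : PredOrder S := LinearLocallyFiniteOrder.predOrder S
  let e : S ≃o ℤ := orderIsoIntOfLinearSuccPredArch
  refine ⟨fun k => (e.symm k).1, fun a b h => e.symm.strictMono h, ?_⟩
  ext m
  constructor
  · rintro ⟨k, rfl⟩; exact (e.symm k).2
  · intro hm; exact ⟨e ⟨m, hm⟩, by simp⟩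

section

variable {n : ℕ}

theorem exists_isDerived {w : Word n}
    (h : ∀ k : ℤ, ∃ k', k < k' ∧ k' ≤ k + 2 * n ∧ Sandwiched w k') : ∃ v, IsDerived w v := by
  obtain ⟨f, hf, hr⟩ := exists_strictMono_range_eq (P := Sandwiched w)
    (fun k => let ⟨k', a, _, c⟩ := h k; ⟨k', a, c⟩)
    (fun k => let ⟨k', _, b, c⟩ := h (k - 2 * n - 1); ⟨k', by omega, c⟩)
  exact ⟨fun m => w (f m), f, hf, hr, fun _ => rfl⟩

/-- Derivation commutes with relabelling, so the iterated derived words are the words `W k` with the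
permutations undone. Their product `ρ k` is dihedral and thus preserves admissibility. -/
theorem isInfinitelyDerivable_of_renormalized [NeZero n] {s : ℕ → ℕ} {W : ℕ → Word n}
    (hs : ∀ k, s k < 2 * n) (hA : ∀ k, W k ∈ admissibleIn n (s k))
    (hd : ∀ k, IsDerived (relabel (perm n (s k)) (W k)) (W (k + 1))) :
    IsInfinitelyDerivable n (W 0) := by
  let ρ : ℕ → Equiv.Perm (ZMod n) := fun k =>
    Nat.rec 1 (fun k p => p * (perm n (s k))⁻¹) k
  have hρ : ∀ k, IsDihedral (ρ k) := by
    intro k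
    induction k with
    | zero => exact isDihedral_one
    | succ k ih => exact ih.mul (isDihedral_perm _).inv
  have adm : ∀ k, IsAdmissible n (relabel (ρ k) (W k)) := fun k =>
    IsAdmissible.relabel ⟨s k, hs k, hA k⟩ (hρ k)
  have der : ∀ k, IsDerived (relabel (ρ k) (W k)) (relabel (ρ (k + 1)) (W (k + 1))) := by
    intro k
    have := (hd k).relabel (ρ (k + 1))
    rw [relabel_relabel] at this
    have e : ρ (k + 1) * perm n (s k) = ρ k := inv_mul_cancel_right _ _
    rwa [e] at this
  exact ⟨fun k => relabel (ρ k) (W k), rfl, der, fun k => ⟨adm k, _, der k, adm (k + 1)⟩⟩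

/-! ### Generated words -/

theorem isGenerated0_iff [NeZero n] (hn : 3 ≤ n) {j : ℕ} (hj : j < 2 * n) {v W : Word n} :
    IsGenerated0 n j v W ↔ ∃ f : ℤ → ℤ,
      (∀ m, startPlace n (j / 2) (v m) < 2 * n - 1 - startPlace n (j / 2) (v (m + 1)) ∧
        f (m + 1) = f m + ((2 * n - 1 - startPlace n (j / 2) (v (m + 1)) -
          startPlace n (j / 2) (v m) : ℕ) : ℤ)) ∧
      ∀ (m : ℤ) (r : ℕ), f m + r < f (m + 1) →
        W (f m + r) = snake n (startPlace n (j / 2) (v m) + r) := by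
  constructor
  · rintro ⟨f, hf, h⟩
    refine ⟨f, fun m => ?_, fun m r hr => ?_⟩
    · obtain ⟨u, hu, hf', -⟩ := h m
      rw [isInterpolatingWord_iff hn hj] at hu
      obtain ⟨hlt, rfl⟩ := hu
      refine ⟨hlt, ?_⟩
      rw [hf', List.length_map, List.length_range']
      omega
    · obtain ⟨u, hu, hf', hW⟩ := h m
      rw [isInterpolatingWord_iff hn hj] at hu
      obtain ⟨hlt, rfl⟩ := hu
      rw [List.length_map, List.length_range'] at hf'
      cases r with
      | zero => simp [hf, snake_startPlace]
      | succ r =>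
        have := hW r (by rw [List.length_map, List.length_range']; omega)
        rw [List.getElem_map, List.getElem_range'] at this
        rw [show f m + ((r + 1 : ℕ) : ℤ) = f m + 1 + r by push_cast; ring, this]
        congr 1; ring
  · rintro ⟨f, hf, hW⟩
    refine ⟨f, fun m => ?_, fun m => ?_⟩
    · have := hf m
      have := hW m 0 (by omega)
      simpa [snake_startPlace] using this
    · refine ⟨_, (isInterpolatingWord_iff hn hj).2 ⟨(hf m).1, rfl⟩, ?_, ?_⟩
      · have := hf m
        rw [List.length_map, List.length_range']; omega
      · intro r hr
        have h1 := hf m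
        have := hW m (r + 1) (by rw [List.length_map, List.length_range'] at hr; push_cast; omega)
        rw [List.getElem_map, List.getElem_range',
          show f m + 1 + r = f m + ((r + 1 : ℕ) : ℤ) by push_cast; ring, this]
        congr 1; ring

/-- A word is generated from its derived word. -/
theorem isGenerated0_of_isDerived [NeZero n] (hn : 3 ≤ n) {j : ℕ} (hj : j < 2 * n) {v W : Word n}
    (hA : W ∈ admissibleIn n 0) (hG : InGroup n (j / 2) W) (hd : IsDerived W v) :
    IsGenerated0 n j v W := by
  rw [isGenerated0_iff hn hj]
  rw [mem_admissibleIn_zero] at hA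
  obtain ⟨f, hf, hr, hv⟩ := hd
  have hl : j / 2 < n := by omega
  have sand : ∀ m, W (f m - 1) = groupLetter n (j / 2) (W (f m)) ∧
      W (f m + 1) = groupLetter n (j / 2) (W (f m)) := by
    intro m
    have : f m ∈ Set.range f := ⟨m, rfl⟩
    rw [hr] at this
    obtain ⟨L, hL⟩ := this
    have e := hG _ _ hL
    exact ⟨hL.1.trans e, hL.2.trans e⟩
  -- The group fixes the place at which a stretch starts. Up to the next sandwiched letter the word
  -- never turns back, and the only other edge continues the snake.
  have path : ∀ (m : ℤ) (r : ℕ), f m + r < f (m + 1) →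
      startPlace n (j / 2) (v m) + r + 1 < 2 * n ∧
      W (f m + r) = snake n (startPlace n (j / 2) (v m) + r) ∧
      W (f m + r + 1) = snake n (startPlace n (j / 2) (v m) + r + 1) := by
    intro m r
    induction r with
    | zero =>
      intro _
      refine ⟨startPlace_lt hl _, ?_, ?_⟩
      · simp [snake_startPlace, hv]
      · simp [snake_startPlace_add_one, (sand m).2, hv]
    | succ r ih =>
      intro hlt
      push_cast at hlt ⊢
      obtain ⟨h1, h2, h3⟩ := ih (by omega)
      have hns : ¬Sandwiched W (f m + r + 1) := by
        intro hs
        have : f m + r + 1 ∈ Set.range f := by rw [hr]; exact hs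
        obtain ⟨m', hm'⟩ := this
        have a1 := hf.lt_iff_lt.1 (show f m < f m' by omega)
        have a2 := hf.lt_iff_lt.1 (show f m' < f (m + 1) by omega)
        omega
      rw [sandwiched_iff, add_sub_cancel_right, h2] at hns
      have hE := hA (f m + r + 1)
      rw [h3] at hE
      obtain ⟨h4, h5⟩ := eq_snake_of_edge0 hn (by omega) h1 hE (by rwa [Nat.add_sub_cancel])
      refine ⟨h4, ?_, ?_⟩
      · rw [← add_assoc, h3]; rfl
      · rw [← add_assoc, h5]; rfl
  refine ⟨f, fun m => ?_, fun m r h => (path m r h).2.1⟩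
  have hlt := hf (show m < m + 1 by omega)
  obtain ⟨r, hr'⟩ : ∃ r : ℕ, f m + r + 1 = f (m + 1) := ⟨(f (m + 1) - f m - 1).toNat, by omega⟩
  obtain ⟨h1, h2, h3⟩ := path m r (by omega)
  have h4 := (sand (m + 1)).1
  rw [← hr', add_sub_cancel_right, h2, h3] at h4
  -- The group also prescribes the letter before the next sandwiched one, which fixes the place
  -- where the stretch ends.
  have h5 := eq_reflect_startPlace hn (l := j / 2) (by omega) h1 (by rwa [Nat.add_sub_cancel])
  rw [← h3, hr', ← hv] at h5
  omega

/-- The letters of the generating word are sandwiched in the generated word. -/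
theorem sandwiched_of_generated [NeZero n] {l : ℕ} (hl : l < n) {v W : Word n} {f : ℤ → ℤ}
    (hf : ∀ m, startPlace n l (v m) < 2 * n - 1 - startPlace n l (v (m + 1)) ∧
      f (m + 1) = f m + ((2 * n - 1 - startPlace n l (v (m + 1)) - startPlace n l (v m) : ℕ) : ℤ))
    (hW : ∀ (m : ℤ) (r : ℕ), f m + r < f (m + 1) → W (f m + r) = snake n (startPlace n l (v m) + r)) :
    (∀ m (r : ℕ), f m + r < f (m + 1) → W (f m + r + 1) = snake n (startPlace n l (v m) + r + 1)) ∧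
    ∀ m, W (f m + 1) = W (f m - 1) := by
  have next : ∀ m (r : ℕ), f m + r < f (m + 1) →
      W (f m + r + 1) = snake n (startPlace n l (v m) + r + 1) := by
    intro m r hr
    have h1 := hf m
    have h2 := hf (m + 1)
    rcases lt_or_ge (f m + r + 1) (f (m + 1)) with h | h
    · have := hW m (r + 1) (by push_cast; omega)
      push_cast at this
      rw [← add_assoc] at this
      rw [this]; rfl
    · have := hW (m + 1) 0 (by push_cast; omega)
      rw [Nat.cast_zero, add_zero, add_zero, snake_startPlace] at this
      rw [show f m + r + 1 = f (m + 1) by omega, this,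
        show startPlace n l (v m) + r + 1 = 2 * n - 1 - startPlace n l (v (m + 1)) by omega,
        snake_reflect_startPlace hl]
  refine ⟨next, fun m => ?_⟩
  have h1 := hf m
  have h2 := hf (m - 1)
  rw [sub_add_cancel] at h2
  have e1 := next m 0 (by push_cast; omega)
  obtain ⟨r, hr⟩ : ∃ r : ℕ, f m - 1 = f (m - 1) + r := ⟨(f m - 1 - f (m - 1)).toNat, by omega⟩
  have e2 := hW (m - 1) r (by rw [sub_add_cancel]; omega)
  rw [← hr, show startPlace n l (v (m - 1)) + r = 2 * n - 1 - startPlace n l (v m) - 1 by omega,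
    snake_reflect_startPlace_sub_one hl] at e2
  rw [Nat.cast_zero, add_zero, add_zero, snake_startPlace_add_one] at e1
  rw [e1, e2]

/-- Infinitely coherent words are generated. -/
theorem mem_generatedSet_of_coherent [NeZero n] (hn : 3 ≤ n) {s : ℕ → ℕ} {W : ℕ → Word n}
    (hd : ∀ k, IsDerived (relabel (perm n (s k)) (W k)) (W (k + 1)))
    (hc : ∀ k, IsCoherentWith n (s k) (s (k + 1)) (W k)) (k m : ℕ) :
    W m ∈ generatedSet n k fun i => s (m + i) := by
  induction k generalizing m with
  | zero => exact (hc m).2.2.1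
  | succ k ih =>
    refine ⟨W (m + 1), ?_, (hc (m + 1)).2.2.1, relabel (perm n (s m)) (W m), ?_, ?_⟩
    · have := ih (m + 1)
      simpa only [add_assoc, add_comm 1] using this
    · obtain ⟨-, -, hA, l, -, hG, ⟨-, hj, -⟩, rfl⟩ := hc m
      exact isGenerated0_of_isDerived hn hj (mem_admissibleIn_iff_relabel.1 hA) hG (hd m)
    · exact (relabel_inv_relabel _ _).symm

theorem infinitelyCoherent_subset [NeZero n] (hn : 3 ≤ n) :
    infinitelyCoherent n ⊆ ⋂ k : ℕ,
      ⋃ s ∈ {s : ℕ → ℕ | s 0 < 2 * n ∧ ∀ m, 1 ≤ m → m ≤ k → 1 ≤ s m ∧ s m < 2 * n},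
        generatedSet n k s := by
  rintro w ⟨s, hs, -, W, rfl, hd, hc⟩
  simp only [Set.mem_iInter, Set.mem_iUnion, Set.mem_ofPred_eq]
  intro k
  refine ⟨s, ⟨(hs 0).1, fun m hm _ => ⟨?_, (hs m).1⟩⟩, ?_⟩
  · by_contra h
    have := (hs m).2 (by omega)
    omega
  · simpa using mem_generatedSet_of_coherent hn hd hc k 0

/-! ### Realization of finite blocks -/

/-- If all interior letters of a block are sandwiched, the block alternates between its first two
letters and is part of a periodic word of a cylinder. -/
theorem exists_realization_of_alternating [NeZero n] (hn : 1 < n) {i : ℕ} {w : Word n} {a b : ℤ}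
    (h0 : Edge n i (w a) (w (a + 1))) (h : ∀ k, a < k → k < b → w (k + 1) = w (k - 1)) :
    ∃ c ∈ sectorWords n i, ∀ k, a ≤ k → k ≤ b → c k = w k := by
  refine ⟨fun k => if Even (k - a) then w a else w (a + 1), ?_, fun k hk hk' => ?_⟩
  · rw [mem_sectorWords_iff (by omega)]
    convert sectorWords_shift (alternating_mem_sectorWords hn h0) (-a) using 1
    ext k
    simp only [relabel, ← sub_eq_add_neg]
    split_ifs <;> rfl
  · have key : ∀ d : ℕ, (a + d ≤ b → w (a + d) = if Even d then w a else w (a + 1)) ∧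
        (a + d + 1 ≤ b → w (a + d + 1) = if Even d then w (a + 1) else w a) := by
      intro d
      induction d with
      | zero => simp
      | succ d ih =>
        push_cast
        refine ⟨fun hd => ?_, fun hd => ?_⟩
        · rw [← add_assoc, ih.2 (by omega)]
          simp only [Nat.even_add_one, ite_not]
        · have := h (a + d + 1) (by omega) (by omega)
          rw [← add_assoc, this, add_sub_cancel_right, ih.1 (by omega)]
          simp only [Nat.even_add_one, ite_not]
    obtain ⟨d, rfl⟩ : ∃ d : ℕ, k = a + d := ⟨(k - a).toNat, by omega⟩
    rw [(key d).1 hk']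
    simp [Int.even_coe_nat]

/-- Realized blocks of the generating word give realized blocks of the generated word. -/
theorem exists_realization_of_generated [NeZero n] (hn : 1 < n) {j : ℕ} (hj : 1 ≤ j)
    (hj' : j < 2 * n) {v W : Word n} {f : ℤ → ℤ} (hmono : StrictMono f)
    (hf : ∀ m, f (m + 1) = f m + ((2 * n - 1 - startPlace n (j / 2) (v (m + 1)) -
      startPlace n (j / 2) (v m) : ℕ) : ℤ))
    (hW : ∀ (m : ℤ) (r : ℕ), f m + r < f (m + 1) →
      W (f m + r) = snake n (startPlace n (j / 2) (v m) + r))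
    {v' : Word n} (hv' : v' ∈ sectorWords n j) {c d : ℤ} (h : ∀ m, c ≤ m → m ≤ d → v' m = v m) :
    ∃ W' ∈ sectorWords n 0, ∀ k, f c ≤ k → k ≤ f d → W' k = W k := by
  obtain ⟨hlt, hgen⟩ := generate_sectorWords hn hj hj' hv'
  obtain ⟨S, -, hS⟩ := exists_int_primitive fun m => ((2 * n - 1 -
    startPlace n (j / 2) (v' (m + 1)) - startPlace n (j / 2) (v' m) : ℕ) : ℤ)
  -- The positions are determined up to a constant, chosen here to place the letter `c` at `f c`.
  obtain ⟨W', hW', hW''⟩ := hgen (fun m => S m + (f c - S c)) (fun m => by rw [hS]; ring)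
  refine ⟨W', hW', fun k hk hk' => ?_⟩
  have e : ∀ m, c ≤ m → m ≤ d → S m + (f c - S c) = f m := by
    intro m hm
    induction m, hm using Int.leInduction with
    | base => intro _; ring
    | succ m hm ih =>
      intro hd
      rw [hf, ← ih (by omega), hS, h m hm (by omega), h (m + 1) (by omega) hd]
      ring
  obtain ⟨m, hm1, hm2⟩ := exists_le_lt_of_strictMono hmono k
  have a1 : c < m + 1 := hmono.lt_iff_lt.1 (by omega)
  have a2 : m ≤ d := hmono.le_iff_le.1 (by omega)
  obtain ⟨r, rfl⟩ : ∃ r : ℕ, k = f m + r := ⟨(k - f m).toNat, by omega⟩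
  rw [hW m r hm2, ← h m (by omega) a2]
  have e1 := e m (by omega) a2
  rw [← e1]
  refine hW'' m r ?_
  rcases a2.lt_or_eq with hd | rfl
  · rw [e1, e (m + 1) (by omega) (by omega)]
    exact hm2
  · have := hlt m
    have hr : r = 0 := by omega
    subst hr
    rw [hS]
    push_cast
    omega

/-- Each generation gains one letter. A block comes from a block of the generating word. If that one
is no longer than the induction allows, it is realized and its realization is generated; otherwise
no letters were inserted between its interior letters, so all of these are sandwiched and the block
alternates. -/
theorem exists_realization_of_mem_generatedSet [NeZero n] (hn : 3 ≤ n) (k : ℕ) (s : ℕ → ℕ)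
    (hs : ∀ m, 1 ≤ m → m ≤ k → 1 ≤ s m ∧ s m < 2 * n) {w : Word n} (hw : w ∈ generatedSet n k s)
    (a : ℤ) : ∃ c ∈ sectorWords n (s 0), ∀ m, a ≤ m → m ≤ a + k + 1 → c m = w m := by
  induction k generalizing s w a with
  | zero =>
    refine exists_realization_of_alternating (by omega) (hw a) fun m h1 h2 => ?_
    push_cast at h2
    omega
  | succ k ih =>
    obtain ⟨v, hv, -, W, hgen, rfl⟩ := hw
    obtain ⟨hj, hj'⟩ := hs 1 le_rfl (by omega)
    rw [isGenerated0_iff hn hj'] at hgen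
    obtain ⟨f, hf, hW⟩ := hgen
    have hmono : StrictMono f := strictMono_int_of_lt_succ fun m => by have := hf m; omega
    obtain ⟨hnext, hsand⟩ := sandwiched_of_generated (by omega) hf hW
    obtain ⟨c, hc1, hc2⟩ := exists_le_lt_of_strictMono hmono a
    obtain ⟨d, hd1, hd2⟩ := exists_le_lt_of_strictMono hmono (a + k + 1)
    -- The places `f c` and `f (d + 1)` enclose the block, so the letters `c, ..., d + 1` of `v`
    -- generate it; they number at most `k + 2` in the first case.
    rcases le_or_gt (d - c) k with hcd | hcd
    · obtain ⟨v', hv', hvv⟩ := ih (fun m => s (m + 1))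
        (fun m h1 h2 => hs (m + 1) (by omega) (by omega)) hv c
      obtain ⟨W', hW', hWW⟩ := exists_realization_of_generated (by omega) hj hj' hmono
        (fun m => (hf m).2) hW hv' (c := c) (d := d + 1) fun m h1 h2 => hvv m h1 (by omega)
      refine ⟨relabel (perm n (s 0))⁻¹ W', ?_, fun m h1 h2 => ?_⟩
      · rwa [mem_sectorWords_iff (by omega), relabel_relabel_inv]
      · push_cast at h2
        exact congrArg _ (hWW m (by omega) (by omega))
    · apply exists_realization_of_alternating (by omega)
      · obtain ⟨r, rfl⟩ : ∃ r : ℕ, a = f c + r := ⟨(a - f c).toNat, by omega⟩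
        have h1 := hf c
        have h2 := edge0_snake (n := n) (t := startPlace n (s 1 / 2) (v c) + r) (by omega)
        rw [← hW c r hc2, ← hnext c r hc2] at h2
        simpa [Edge, relabel] using h2
      · intro m h1 h2
        push_cast at h2
        -- At least `k + 1` distinct places `f (c + 1), ..., f d` lie among `a + 1, ..., a + k + 1`,
        -- hence exhaust them.
        have i1 := strictMono_int_add_le hmono (show c + 1 ≤ c + (m - a) by omega)
        have i2 := strictMono_int_add_le hmono (show c + (m - a) ≤ d by omega)
        have e : f (c + (m - a)) = m := by omega
        have := hsand (c + (m - a))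
        rw [e] at this
        simp only [relabel, this]

/-! ### Closures -/

theorem mem_closure_iff_agree {S : Set (Word n)} {w : Word n} :
    w ∈ closure S ↔ ∀ N : ℕ, ∃ c ∈ S, ∀ k : ℤ, -N ≤ k → k ≤ N → c k = w k := by
  constructor
  · intro h N
    have ho : IsOpen (Set.pi (Set.Icc (-N : ℤ) N) fun k => {w k}) :=
      isOpen_set_pi (Set.finite_Icc _ _) fun k _ => isOpen_discrete _
    obtain ⟨c, hc, hcS⟩ := _root_.mem_closure_iff.1 h _ ho fun k _ => rfl
    exact ⟨c, hcS, fun k h1 h2 => hc k ⟨h1, h2⟩⟩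
  · intro h
    rw [_root_.mem_closure_iff]
    intro o ho hw
    obtain ⟨I, u, hu, hI⟩ := isOpen_pi_iff.1 ho w hw
    obtain ⟨c, hc, hcw⟩ := h (I.sup Int.natAbs)
    refine ⟨c, hI fun k hk => ?_, hc⟩
    have : k.natAbs ≤ I.sup Int.natAbs := Finset.le_sup (f := Int.natAbs) hk
    rw [hcw k (by omega) (by omega)]
    exact (hu k hk).2

/-- Depth `2 * N` controls blocks of `2 * N + 2` letters, enough for the window of radius `N`. The
sequence `s` may change with the depth, as each window is treated separately. -/
theorem generated_subset_closure [NeZero n] (hn : 3 ≤ n) :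
    (⋂ k : ℕ, ⋃ s ∈ {s : ℕ → ℕ | s 0 < 2 * n ∧ ∀ m, 1 ≤ m → m ≤ k → 1 ≤ s m ∧ s m < 2 * n},
        generatedSet n k s) ⊆ closure (⋃ i ∈ Set.Iio (2 * n), sectorWords n i) := by
  intro w hw
  simp only [Set.mem_iInter, Set.mem_iUnion, Set.mem_ofPred_eq] at hw
  rw [mem_closure_iff_agree]
  intro N
  obtain ⟨s, ⟨hs0, hs⟩, hw⟩ := hw (2 * N)
  obtain ⟨c, hc, hcw⟩ := exists_realization_of_mem_generatedSet hn _ s hs hw (-N)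
  exact ⟨c, Set.mem_biUnion hs0 hc, fun k h1 h2 => hcw k h1 (by push_cast; omega)⟩

/-- The limits of words of a sector have the same renormalization as these words. -/
theorem renormalize_closure [NeZero n] (hn : 3 ≤ n) {i : ℕ} {w : Word n}
    (hw : w ∈ closure (sectorWords n i)) :
    w ∈ admissibleIn n i ∧ ∃ j, 1 ≤ j ∧ j < 2 * n ∧ InGroup n (j / 2) (relabel (perm n i) w) ∧
      ∃ v ∈ closure (sectorWords n j), IsDerived (relabel (perm n i) w) v := by
  rw [mem_admissibleIn_iff_relabel]
  have hw0 : ∀ N : ℕ, ∃ c ∈ sectorWords n 0, ∀ k : ℤ, -N ≤ k → k ≤ N →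
      c k = relabel (perm n i) w k := by
    intro N
    obtain ⟨c, hc, hcw⟩ := mem_closure_iff_agree.1 hw N
    exact ⟨_, (mem_sectorWords_iff (by omega)).1 hc, fun k h1 h2 => congrArg _ (hcw k h1 h2)⟩
  generalize relabel (perm n i) w = W at hw0
  -- Each approximating word has its own renormalized sector; as there are finitely many, one `j`
  -- serves for windows of every size.
  obtain ⟨j, hj, hj', hQ⟩ : ∃ j, 1 ≤ j ∧ j < 2 * n ∧ ∀ N : ℕ, ∃ c ∈ sectorWords n 0,
      (∀ k : ℤ, -N ≤ k → k ≤ N → c k = W k) ∧ InGroup n (j / 2) c ∧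
        ∀ v, IsDerived c v → v ∈ sectorWords n j := by
    by_contra! hc
    choose! N hN using hc
    obtain ⟨c, hc, hcW⟩ := hw0 ((Finset.range (2 * n)).sup N)
    obtain ⟨-, -, j, hj, hj', hG, hd⟩ := derive_sectorWords hn hc
    have hle : N j ≤ (Finset.range (2 * n)).sup N := Finset.le_sup (by simpa using hj')
    obtain ⟨v, hv, hv'⟩ := hN j hj hj' c hc (fun k h1 h2 => hcW k (by omega) (by omega)) hG
    exact hv' (hd v hv)
  have gap : ∀ k : ℤ, ∃ k', k < k' ∧ k' ≤ k + 2 * n ∧ Sandwiched W k' := by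
    intro k
    obtain ⟨c, hc, hcW⟩ := hw0 (k.natAbs + 2 * n + 1)
    obtain ⟨-, hgap, -⟩ := derive_sectorWords hn hc
    obtain ⟨k', h1, h2, h3⟩ := hgap k
    refine ⟨k', h1, h2, ?_⟩
    rw [sandwiched_iff] at h3 ⊢
    rwa [← hcW _ (by omega) (by omega),
      ← hcW _ (by omega) (by omega)]
  refine ⟨?_, j, hj, hj', ?_, ?_⟩
  · rw [mem_admissibleIn_zero]
    intro k
    obtain ⟨c, hc, hcW⟩ := hw0 (k.natAbs + 1)
    obtain ⟨hA, -⟩ := derive_sectorWords hn hc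
    rw [← hcW k (by omega) (by omega), ← hcW (k + 1) (by omega) (by omega)]
    exact mem_admissibleIn_zero.1 hA k
  · intro k L hL
    obtain ⟨c, -, hcW, hG, -⟩ := hQ (k.natAbs + 1)
    rw [← hcW k (by omega) (by omega)]
    refine hG k L ⟨?_, ?_⟩
    · rw [hcW _ (by omega) (by omega)]; exact hL.1
    · rw [hcW _ (by omega) (by omega)]; exact hL.2
  · obtain ⟨v, hv⟩ := exists_isDerived gap
    refine ⟨v, ?_, hv⟩
    obtain ⟨f, hf, hr, hvf⟩ := hv
    rw [mem_closure_iff_agree]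
    intro N
    obtain ⟨c, hc, hcW, -, hd⟩ := hQ ((f (-N)).natAbs + (f N).natAbs + 1)
    obtain ⟨-, hgap, -⟩ := derive_sectorWords hn hc
    obtain ⟨v', hv'⟩ := exists_isDerived hgap
    have hmem := hd v' hv'
    obtain ⟨f', hf', hr', hvf'⟩ := hv'
    have bound : ∀ k, f (-N) ≤ k → k ≤ f N → (Sandwiched c k ↔ Sandwiched W k) := by
      intro k h1 h2
      rw [sandwiched_iff, sandwiched_iff, hcW _ (by omega) (by omega),
        hcW _ (by omega) (by omega)]
    have inf : ∀ m, Sandwiched W (f m) := fun m => by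
      have : f m ∈ Set.range f := ⟨m, rfl⟩
      rwa [hr] at this
    have inf' : ∀ m, Sandwiched c (f' m) := fun m => by
      have : f' m ∈ Set.range f' := ⟨m, rfl⟩
      rwa [hr'] at this
    have lift : ∀ k, Sandwiched W k → ∃ m, f m = k := fun k hk => by
      have : k ∈ Set.range f := by rw [hr]; exact hk
      exact this
    have lift' : ∀ k, Sandwiched c k → ∃ m, f' m = k := fun k hk => by
      have : k ∈ Set.range f' := by rw [hr']; exact hk
      exact this
    obtain ⟨p, hp⟩ := lift' (f (-N)) ((bound _ le_rfl (hf.monotone (by omega))).2 (inf _))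
    -- In the window from `f (-N)` to `f N` the sandwiched places of `c` and `W` coincide, so their
    -- increasing enumerations differ only by a shift.
    have key : ∀ d : ℕ, d ≤ 2 * N → f' (p + d) = f (-N + d) := by
      intro d
      induction d with
      | zero => simpa using hp
      | succ d ih =>
        intro hd
        have ih := ih (by omega)
        have i1 : f (-N) ≤ f (-N + (d + 1 : ℕ)) := hf.monotone (by omega)
        have i2 : f (-N + (d + 1 : ℕ)) ≤ f N := hf.monotone (by omega)
        have i3 : f (-N) ≤ f (-N + d) := hf.monotone (by omega)
        have i4 : f (-N + d) < f (-N + (d + 1 : ℕ)) := hf (by omega)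
        obtain ⟨q, hq⟩ := lift' _ ((bound _ i1 i2).2 (inf _))
        have hq1 : p + d < q := hf'.lt_iff_lt.1 (by omega)
        have i5 : f' (p + (d + 1 : ℕ)) ≤ f' q := hf'.monotone (by push_cast; omega)
        have i6 : f' (p + d) < f' (p + (d + 1 : ℕ)) := hf' (by push_cast; omega)
        obtain ⟨r, hr⟩ := lift _ ((bound (f' (p + (d + 1 : ℕ))) (by omega) (by omega)).1 (inf' _))
        have hr1 : -N + d < r := hf.lt_iff_lt.1 (by omega)
        have i7 : f (-N + (d + 1 : ℕ)) ≤ f r := hf.monotone (by push_cast; omega)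
        omega
    refine ⟨fun m => v' (m + (p + N)), sectorWords_shift hmem _, fun m h1 h2 => ?_⟩
    have e := key (m + N).toNat (by omega)
    rw [show p + ((m + N).toNat : ℤ) = m + (p + N) by omega,
      show -(N : ℤ) + ((m + N).toNat : ℤ) = m by omega] at e
    have b1 : f (-N) ≤ f m := hf.monotone h1
    have b2 : f m ≤ f N := hf.monotone h2
    beta_reduce
    rw [hvf', hvf, e, hcW _ (by omega) (by omega)]

/-- The closure of a finite union is the union of the closures, so a limit belongs to one sector;
`renormalize_closure` is then iterated on pairs of a sector and a word. -/
theorem closure_subset_infinitelyCoherent [NeZero n] (hn : 3 ≤ n) :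
    closure (⋃ i ∈ Set.Iio (2 * n), sectorWords n i) ⊆ infinitelyCoherent n := by
  intro w hw
  rw [(Set.finite_Iio (2 * n)).closure_biUnion] at hw
  obtain ⟨i, hi, hw⟩ := Set.mem_iUnion₂.1 hw
  let S := {q : ℕ × Word n // q.1 < 2 * n ∧ q.2 ∈ closure (sectorWords n q.1)}
  have step : ∀ q : S, ∃ q' : S, 1 ≤ q'.1.1 ∧ InGroup n (q'.1.1 / 2) (relabel (perm n q.1.1) q.1.2) ∧
      IsDerived (relabel (perm n q.1.1) q.1.2) q'.1.2 := by
    intro q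
    obtain ⟨-, j, hj, hj', hG, v, hv, hd⟩ := renormalize_closure hn q.2.2
    exact ⟨⟨(j, v), hj', hv⟩, hj, hG, hd⟩
  choose next h1 h2 h3 using step
  let Q : ℕ → S := fun k => next^[k] ⟨(i, w), hi, hw⟩
  have hQ : ∀ k, Q (k + 1) = next (Q k) := fun k => Function.iterate_succ_apply' _ _ _
  have hA : ∀ k, (Q k).1.2 ∈ admissibleIn n (Q k).1.1 := fun k =>
    (renormalize_closure hn (Q k).2.2).1
  have hd : ∀ k, IsDerived (relabel (perm n (Q k).1.1) (Q k).1.2) (Q (k + 1)).1.2 := fun k => by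
    rw [hQ]; exact h3 _
  have hlt : ∀ k, (Q k).1.1 < 2 * n := fun k => (Q k).2.1
  have hpos : ∀ k, 1 ≤ (Q (k + 1)).1.1 := fun k => by rw [hQ]; exact h1 _
  refine ⟨fun k => (Q k).1.1, fun k => ⟨hlt k, fun hk => ?_⟩,
    isInfinitelyDerivable_of_renormalized (W := fun k => (Q k).1.2) hlt hA hd,
    fun k => (Q k).1.2, rfl, hd, fun k => ⟨⟨⟨_, hlt k, hA k⟩, ?_⟩, hlt k, hA k, (Q (k + 1)).1.1 / 2, ?_,
      ?_, ⟨hpos k, hlt _, _, hd k, hA _⟩, rfl⟩⟩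
  · cases k with
    | zero => rfl
    | succ k => exact absurd hk (Nat.one_le_iff_ne_zero.1 (hpos k))
  · have := (hd k).relabel (perm n (Q k).1.1)⁻¹
    rw [relabel_inv_relabel] at this
    exact ⟨_, this, IsAdmissible.relabel ⟨_, hlt _, hA _⟩ (isDihedral_perm _).inv⟩
  · have h4 := hlt (k + 1)
    exact Nat.div_lt_of_lt_mul h4
  · rw [hQ]; exact h2 _

end
/-! ### Trajectories and codings -/

/-- The scalar product of `z` with the outer normal of side `a`, for an integral side number. -/
noncomputable def support (n : ℕ) (a : ℤ) (z : ℂ) : ℝ :=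
  z.re * sin (2 * a * halfAngle n) + z.im * cos (2 * a * halfAngle n)

/-- The point on the line of side `a` at (clockwise) distance `s` from the middle of the side. -/
noncomputable def sidePoint (n : ℕ) (a : ℤ) (s : ℝ) : ℂ :=
  ⟨sin (2 * a * halfAngle n) + s * cos (2 * a * halfAngle n),
    cos (2 * a * halfAngle n) - s * sin (2 * a * halfAngle n)⟩

/-- The coordinate of `z` transversally to the direction `θ`. -/
noncomputable def cross (θ : ℝ) (z : ℂ) : ℝ := cos θ * z.im - sin θ * z.re

/-- The coordinate of `z` along the direction `θ`. -/
noncomputable def along (θ : ℝ) (z : ℂ) : ℝ := cos θ * z.re + sin θ * z.im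

section

variable {n : ℕ}

theorem normal_re (hn : 0 < n) (i : Fin (2 * n)) :
    (normal n i).re = sin (2 * ((i : ℕ) : ℤ) * halfAngle n) := by
  have : (n : ℝ) ≠ 0 := by positivity
  rw [normal, Complex.exp_ofReal_mul_I_re, cos_pi_div_two_sub, halfAngle]
  congr 1; push_cast; field_simp

theorem normal_im (hn : 0 < n) (i : Fin (2 * n)) :
    (normal n i).im = cos (2 * ((i : ℕ) : ℤ) * halfAngle n) := by
  have : (n : ℝ) ≠ 0 := by positivity
  rw [normal, Complex.exp_ofReal_mul_I_im, sin_pi_div_two_sub, halfAngle]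
  congr 1; push_cast; field_simp

theorem height_eq_support (hn : 0 < n) (i : Fin (2 * n)) (z : ℂ) :
    height n i z = support n (i : ℕ) z := by
  rw [height, support, Complex.mul_re, Complex.conj_re, Complex.conj_im, normal_re hn, normal_im hn]
  ring

theorem sin_add_two_mul (hn : 0 < n) (θ : ℝ) (a q : ℤ) :
    sin (θ + 2 * ((a + 2 * n * q : ℤ) : ℝ) * halfAngle n) = sin (θ + 2 * a * halfAngle n) := by
  have e := two_mul_halfAngle hn
  rw [← sin_add_int_mul_two_pi (θ + 2 * a * halfAngle n) q]
  congr 1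
  push_cast
  linear_combination (2 * (q : ℝ)) * e

theorem cos_add_two_mul (hn : 0 < n) (a q : ℤ) :
    cos (2 * ((a + 2 * n * q : ℤ) : ℝ) * halfAngle n) = cos (2 * a * halfAngle n) := by
  have e := two_mul_halfAngle hn
  rw [← cos_add_int_mul_two_pi (2 * a * halfAngle n) q]
  congr 1
  push_cast
  linear_combination (2 * (q : ℝ)) * e

theorem support_add_mul (hn : 0 < n) (a q : ℤ) (z : ℂ) :
    support n (a + 2 * n * q) z = support n a z := by
  have e := sin_add_two_mul hn 0 a q
  rw [zero_add, zero_add] at e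
  rw [support, support, e, cos_add_two_mul hn]

/-- The side with number `a` modulo `2n`. -/
def sideOf (n : ℕ) (hn : 0 < n) (a : ℤ) : Fin (2 * n) :=
  ⟨(a % (2 * n : ℤ)).toNat, by
    have := Int.emod_lt_of_pos a (b := 2 * n) (by omega)
    omega⟩

theorem sideOf_add (hn : 0 < n) (a : ℤ) :
    (((sideOf n hn a : Fin (2 * n)) : ℕ) : ℤ) + 2 * n * (a / (2 * n)) = a := by
  have h1 := Int.emod_nonneg a (b := 2 * n) (by omega)
  have h2 := Int.emod_add_mul_ediv a (2 * n)
  simp only [sideOf]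
  omega

theorem support_sideOf (hn : 0 < n) (a : ℤ) (z : ℂ) :
    support n (sideOf n hn a : ℕ) z = support n a z := by
  conv_rhs => rw [← sideOf_add hn a, support_add_mul hn]

theorem mem_interiorPolygon_iff (hn : 0 < n) {z : ℂ} :
    z ∈ interiorPolygon n ↔ ∀ a : ℤ, support n a z < 1 := by
  constructor
  · intro h a
    rw [← support_sideOf hn, ← height_eq_support hn]
    exact h _
  · intro h i
    rw [height_eq_support hn]
    exact h _

theorem mem_openSide_iff (hn : 0 < n) {i : Fin (2 * n)} {z : ℂ} :
    z ∈ openSide n i ↔ support n (i : ℕ) z = 1 ∧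
      ∀ b : ℤ, ¬ (2 * n : ℤ) ∣ b - (i : ℕ) → support n b z < 1 := by
  constructor
  · rintro ⟨h1, h2⟩
    rw [height_eq_support hn] at h1
    refine ⟨h1, fun b hb => ?_⟩
    rw [← support_sideOf hn, ← height_eq_support hn]
    refine h2 _ fun e => hb ⟨b / (2 * n), ?_⟩
    have := sideOf_add hn b
    rw [e] at this
    linarith
  · rintro ⟨h1, h2⟩
    refine ⟨by rw [height_eq_support hn, h1], fun j hj => ?_⟩
    rw [height_eq_support hn]
    refine h2 _ fun ⟨q, hq⟩ => hj ?_
    have h3 := j.2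
    have h4 := i.2
    have hq1 : q < 1 := by
      by_contra hc
      have : (2 * n : ℤ) * 1 ≤ 2 * n * q := mul_le_mul_of_nonneg_left (by omega) (by omega)
      omega
    have hq2 : -1 < q := by
      by_contra hc
      have : (2 * n : ℤ) * q ≤ 2 * n * (-1) := mul_le_mul_of_nonneg_left (by omega) (by omega)
      omega
    obtain rfl : q = 0 := by omega
    exact Fin.ext (by omega)

theorem support_move (θ t : ℝ) (a : ℤ) (z : ℂ) :
    support n a (z + (t : ℂ) * Complex.exp ((θ : ℂ) * Complex.I)) =
      support n a z + t * sin (θ + 2 * a * halfAngle n) := by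
  simp only [support, Complex.add_re, Complex.add_im, Complex.re_ofReal_mul, Complex.im_ofReal_mul,
    Complex.exp_ofReal_mul_I_re, Complex.exp_ofReal_mul_I_im, sin_add]
  ring

theorem cross_move (θ t : ℝ) (z : ℂ) :
    cross θ (z + (t : ℂ) * Complex.exp ((θ : ℂ) * Complex.I)) = cross θ z := by
  simp only [cross, Complex.add_re, Complex.add_im, Complex.re_ofReal_mul, Complex.im_ofReal_mul,
    Complex.exp_ofReal_mul_I_re, Complex.exp_ofReal_mul_I_im]
  ring

theorem eq_add_of_cross_eq {θ : ℝ} {z z' : ℂ} (h : cross θ z = cross θ z') :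
    z' = z + ((along θ z' - along θ z : ℝ) : ℂ) * Complex.exp ((θ : ℂ) * Complex.I) := by
  have p := sin_sq_add_cos_sq θ
  simp only [cross] at h
  apply Complex.ext
  · simp only [along, Complex.add_re, Complex.re_ofReal_mul, Complex.exp_ofReal_mul_I_re]
    linear_combination (z.re - z'.re) * p + sin θ * h
  · simp only [along, Complex.add_im, Complex.im_ofReal_mul, Complex.exp_ofReal_mul_I_im]
    linear_combination (z.im - z'.im) * p - cos θ * h

theorem support_sidePoint (a b : ℤ) (s : ℝ) : support n b (sidePoint n a s) =
    cos ((2 * (b - a : ℤ)) * halfAngle n) + s * sin ((2 * (b - a : ℤ)) * halfAngle n) := by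
  simp only [support, sidePoint]
  push_cast
  rw [show 2 * ((b : ℝ) - a) * halfAngle n = 2 * b * halfAngle n - 2 * a * halfAngle n by ring,
    cos_sub, sin_sub]
  ring

theorem cross_sidePoint (θ : ℝ) (a : ℤ) (s : ℝ) : cross θ (sidePoint n a s) =
    cos (θ + 2 * a * halfAngle n) - s * sin (θ + 2 * a * halfAngle n) := by
  simp only [cross, sidePoint, cos_add, sin_add]
  ring

theorem along_sidePoint (θ : ℝ) (a : ℤ) (s : ℝ) : along θ (sidePoint n a s) =
    sin (θ + 2 * a * halfAngle n) + s * cos (θ + 2 * a * halfAngle n) := by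
  simp only [along, sidePoint, cos_add, sin_add]
  ring

theorem eq_sidePoint {a : ℤ} {z : ℂ} (h : support n a z = 1) : ∃ s, z = sidePoint n a s := by
  refine ⟨z.re * cos (2 * a * halfAngle n) - z.im * sin (2 * a * halfAngle n), ?_⟩
  have p := sin_sq_add_cos_sq (2 * a * halfAngle n)
  rw [support] at h
  apply Complex.ext
  · simp only [sidePoint]
    linear_combination (-z.re) * p + sin (2 * a * halfAngle n) * h
  · simp only [sidePoint]
    linear_combination (-z.im) * p + cos (2 * a * halfAngle n) * h

theorem sidePoint_add (hn : 0 < n) (a : ℤ) (s : ℝ) :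
    sidePoint n (a + n) (-s) = sidePoint n a s - 2 * sidePoint n a 0 := by
  have e := two_mul_halfAngle hn
  have e1 : 2 * ((a : ℝ) + n) * halfAngle n = 2 * a * halfAngle n + π := by rw [← e]; ring
  apply Complex.ext
  · simp [sidePoint, e1, cos_add_pi, sin_add_pi]; ring
  · simp [sidePoint, e1, cos_add_pi, sin_add_pi]; ring

theorem normal_sideOf (hn : 0 < n) (a : ℤ) : normal n (sideOf n hn a) = sidePoint n a 0 := by
  have e1 := sin_add_two_mul hn 0 ((sideOf n hn a : Fin (2 * n)) : ℕ) (a / (2 * n))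
  have e2 := cos_add_two_mul hn ((sideOf n hn a : Fin (2 * n)) : ℕ) (a / (2 * n))
  rw [sideOf_add] at e1 e2
  rw [zero_add, zero_add] at e1
  apply Complex.ext
  · simp only [sidePoint, normal_re hn, e1, zero_mul, add_zero]
  · simp only [sidePoint, normal_im hn, e2, zero_mul, sub_zero]

theorem abs_lt_of_support_lt (hn : 1 < n) {a : ℤ} {s : ℝ}
    (h1 : support n (a + 1) (sidePoint n a s) < 1) (h2 : support n (a - 1) (sidePoint n a s) < 1) :
    -sin (halfAngle n) < s * cos (halfAngle n) ∧ s * cos (halfAngle n) < sin (halfAngle n) := by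
  have hs := sin_halfAngle_pos hn
  have p := sin_sq_add_cos_sq (halfAngle n)
  rw [support_sidePoint] at h1 h2
  rw [show a + 1 - a = 1 by ring] at h1
  rw [show a - 1 - a = -1 by ring] at h2
  push_cast at h1 h2
  rw [mul_one, sin_two_mul, cos_two_mul] at h1
  rw [show (2 : ℝ) * -1 * halfAngle n = -(2 * halfAngle n) by ring, sin_neg, cos_neg, sin_two_mul,
    cos_two_mul] at h2
  constructor
  · by_contra hc
    nlinarith
  · by_contra hc
    nlinarith

/-- With `x = m * halfAngle n`, one has `1 - cos 2x - s sin 2x = 2 sin x (sin x - s cos x)`. The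
last factor is affine in `s`, and at the two vertices it is proportional to `sin (x ± halfAngle n)`;
these are nonnegative and do not both vanish. -/
theorem support_lt_of_abs_lt (hn : 1 < n) {a b : ℤ} {s : ℝ}
    (h1 : -sin (halfAngle n) < s * cos (halfAngle n)) (h2 : s * cos (halfAngle n) < sin (halfAngle n))
    (hb : ¬ (2 * n : ℤ) ∣ b - a) : support n b (sidePoint n a s) < 1 := by
  have hs := sin_halfAngle_pos hn
  have hc := cos_halfAngle_pos hn
  obtain ⟨m, q, hm0, hm, rfl⟩ : ∃ m q : ℤ, 0 < m ∧ m < 2 * n ∧ b = a + m + 2 * n * q := by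
    have h3 := Int.emod_nonneg (b - a) (b := 2 * n) (by omega)
    have h4 := Int.emod_lt_of_pos (b - a) (b := 2 * n) (by omega)
    have h5 := Int.emod_add_mul_ediv (b - a) (2 * n)
    have h6 : (b - a) % (2 * n) ≠ 0 := fun h => hb (Int.dvd_of_emod_eq_zero h)
    exact ⟨(b - a) % (2 * n), (b - a) / (2 * n), by omega, h4, by linarith⟩
  rw [support_add_mul (by omega), support_sidePoint, show a + m - a = m by ring, mul_assoc,
    cos_two_mul, sin_two_mul]
  have s0 := sin_mul_halfAngle_pos (n := n) (by omega) hm0 hm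
  have s1 := sin_mul_halfAngle_nonneg (n := n) (i := m - 1) (by omega) (by omega) (by omega)
  have s2 := sin_mul_halfAngle_nonneg (n := n) (i := m + 1) (by omega) (by omega) (by omega)
  have p := sin_sq_add_cos_sq (m * halfAngle n)
  push_cast at s1 s2
  rw [sub_mul, one_mul, sin_sub] at s1
  rw [add_mul, one_mul, sin_add] at s2
  set S := sin (m * halfAngle n)
  set C := cos (m * halfAngle n)
  have key : 0 < sin (halfAngle n) * (S * cos (halfAngle n) - s * cos (halfAngle n) * C) := by
    rcases s1.eq_or_lt with h0 | h0
    · have h3 : 0 < S * cos (halfAngle n) + C * sin (halfAngle n) := by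
        have := mul_pos s0 hc
        linarith
      have := mul_pos (sub_pos.2 h2) h3
      have := mul_nonneg (neg_lt_iff_pos_add.1 h1).le s1
      nlinarith
    · have := mul_pos (neg_lt_iff_pos_add.1 h1) h0
      have := mul_nonneg (sub_pos.2 h2).le s2
      nlinarith
  have key2 : 0 < S - s * C := by
    have h3 : 0 < sin (halfAngle n) * cos (halfAngle n) * (S - s * C) := by linarith
    exact pos_of_mul_pos_right h3 (mul_pos hs hc).le
  nlinarith [mul_pos s0 key2]

theorem vertexCoord_cos_sin (θ : ℝ) (a : ℤ) : vertexCoord n (cos θ) (sin θ) a =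
    cos (θ + 2 * a * halfAngle n) * cos (halfAngle n) +
      sin (θ + 2 * a * halfAngle n) * sin (halfAngle n) := by
  rw [vertexCoord, ← cos_add, ← cos_sub]; congr 1; ring

theorem vertexCoord_succ_cos_sin (θ : ℝ) (a : ℤ) : vertexCoord n (cos θ) (sin θ) (a + 1) =
    cos (θ + 2 * a * halfAngle n) * cos (halfAngle n) -
      sin (θ + 2 * a * halfAngle n) * sin (halfAngle n) := by
  rw [vertexCoord, ← cos_add, ← cos_add]; congr 1; push_cast; ring

/-- Cutting sequences are coded by the interval exchange of their direction. -/
theorem isCoded_cuttingSequence (hn : 1 < n) (τ : LinearTrajectory n) :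
    IsCoded n (vertexCoord n (cos τ.θ) (sin τ.θ)) (cuttingSequence τ) := by
  have hn0 : 0 < n := by omega
  -- The polygon has inradius `1`, while `vertexCoord` refers to circumradius `1`; hence the factor
  -- `cos (halfAngle n)`.
  refine ⟨fun k => cross τ.θ (τ.entry k) * cos (halfAngle n), fun k => (τ.side k : ℕ), fun k => ?_⟩
  set a : ℤ := ((τ.side k : ℕ) : ℤ) with ha
  have hlt := τ.time_strictMono (show k < k + 1 by omega)
  obtain ⟨h1, h2⟩ := (mem_openSide_iff hn0).1 (τ.hits k)
  rw [← ha] at h1 h2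
  have hin := (mem_interiorPolygon_iff hn0).1 (τ.inside k ((τ.time k + τ.time (k + 1)) / 2)
    ⟨by linarith, by linarith⟩) a
  -- The trajectory reaches the line of side `a` from inside, so it moves outwards there.
  have hpos : 0 < sin (τ.θ + 2 * a * halfAngle n) := by
    have h1' := h1
    rw [support_move] at h1' hin
    by_contra hc
    nlinarith
  have hre := τ.reenters k
  have hcross : cross τ.θ (τ.entry k + ((τ.time (k + 1) - τ.time k : ℝ) : ℂ) *
      Complex.exp ((τ.θ : ℂ) * Complex.I)) = cross τ.θ (τ.entry k) := cross_move _ _ _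
  set H := τ.entry k + ((τ.time (k + 1) - τ.time k : ℝ) : ℂ) *
    Complex.exp ((τ.θ : ℂ) * Complex.I)
  obtain ⟨s, hs⟩ := eq_sidePoint h1
  have hdvd : ∀ e : ℤ, e = 1 ∨ e = -1 → ¬ (2 * n : ℤ) ∣ e := by
    intro e he hd
    have := Int.le_of_dvd (a := 2 * (n : ℤ)) (b := 1) one_pos (by
      rcases he with rfl | rfl
      · exact hd
      · exact (Int.dvd_neg (b := 1)).1 hd)
    omega
  obtain ⟨b1, b2⟩ := abs_lt_of_support_lt hn
    (by rw [← hs]; exact h2 (a + 1) (hdvd _ (Or.inl (by ring))))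
    (by rw [← hs]; exact h2 (a - 1) (hdvd _ (Or.inr (by ring))))
  rw [hs, cross_sidePoint] at hcross
  have hnext : cross τ.θ (τ.entry (k + 1)) =
      cross τ.θ (τ.entry k) - 2 * cos (τ.θ + 2 * a * halfAngle n) := by
    rw [hre, ← hcross, hs]
    simp only [cross, sidePoint, Complex.sub_re, Complex.sub_im, Complex.mul_re, Complex.mul_im,
      Complex.re_ofNat, Complex.im_ofNat, normal_re hn0, normal_im hn0, cos_add, sin_add]
    rw [← ha]
    ring
  refine ⟨?_, ?_, ?_, ?_⟩
  · simp [cuttingSequence, label]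
  · beta_reduce
    rw [← ha, vertexCoord_succ_cos_sin, ← hcross]
    nlinarith
  · beta_reduce
    rw [← ha, vertexCoord_cos_sin, ← hcross]
    nlinarith
  · beta_reduce
    rw [← ha, hnext, vertexCoord_cos_sin, vertexCoord_succ_cos_sin]
    ring

/-- The sine takes finitely many values, as it depends on `a` modulo `2n`. The bound makes the
crossing times of a constructed trajectory diverge. -/
theorem exists_pos_le_sin (hn : 0 < n) (θ : ℝ) :
    ∃ ε > 0, ∀ a : ℤ, 0 < sin (θ + 2 * a * halfAngle n) → ε ≤ sin (θ + 2 * a * halfAngle n) := by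
  have hfin : ({y | 0 < y} ∩ Set.range fun i : Fin (2 * n) =>
      sin (θ + 2 * (((i : ℕ) : ℤ) : ℝ) * halfAngle n)).Finite := (Set.finite_range _).inter_of_right _
  have hmem : ∀ a : ℤ, 0 < sin (θ + 2 * a * halfAngle n) → sin (θ + 2 * a * halfAngle n) ∈
      {y | 0 < y} ∩ Set.range fun i : Fin (2 * n) =>
        sin (θ + 2 * (((i : ℕ) : ℤ) : ℝ) * halfAngle n) := by
    refine fun a ha => ⟨ha, sideOf n hn a, ?_⟩
    have := sin_add_two_mul hn θ ((sideOf n hn a : Fin (2 * n)) : ℕ) (a / (2 * n))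
    rw [sideOf_add] at this
    exact this.symm
  rcases Set.eq_empty_or_nonempty ({y | 0 < y} ∩ Set.range fun i : Fin (2 * n) =>
      sin (θ + 2 * (((i : ℕ) : ℤ) : ℝ) * halfAngle n)) with h | h
  · exact ⟨1, one_pos, fun a ha => absurd (hmem a ha) (by rw [h]; exact Set.notMem_empty _)⟩
  · obtain ⟨ε, hε, hmin⟩ := Set.exists_min_image _ id hfin h
    exact ⟨ε, hε.1, fun a ha => hmin _ (hmem a ha)⟩

/-- A coded word is a cutting sequence. -/
theorem mem_cuttingSequences_of_isCoded (hn : 1 < n) {θ : ℝ} {w : Word n}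
    (h : IsCoded n (vertexCoord n (cos θ) (sin θ)) w) : w ∈ cuttingSequences n := by
  have hn0 : 0 < n := by omega
  have hsin := sin_halfAngle_pos hn
  have hcos := cos_halfAngle_pos hn
  obtain ⟨x, A, h⟩ := h
  have hpos : ∀ k, 0 < sin (θ + 2 * A k * halfAngle n) := by
    intro k
    obtain ⟨-, h1, h2, -⟩ := h k
    rw [vertexCoord_succ_cos_sin] at h1
    rw [vertexCoord_cos_sin] at h2
    have h3 : 0 < sin (halfAngle n) * sin (θ + 2 * A k * halfAngle n) := by linarith
    exact pos_of_mul_pos_right h3 hsin.le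
  -- the position of the hitting point on its side
  obtain ⟨s, hs⟩ : ∃ s : ℤ → ℝ, ∀ k, x k = (cos (θ + 2 * A k * halfAngle n) -
      s k * sin (θ + 2 * A k * halfAngle n)) * cos (halfAngle n) := by
    refine ⟨fun k => (cos (θ + 2 * A k * halfAngle n) - x k / cos (halfAngle n)) /
      sin (θ + 2 * A k * halfAngle n), fun k => ?_⟩
    have := (hpos k).ne'
    field_simp
    ring
  have hbound : ∀ k, -sin (halfAngle n) < s k * cos (halfAngle n) ∧
      s k * cos (halfAngle n) < sin (halfAngle n) := by
    intro k
    obtain ⟨-, h1, h2, -⟩ := h k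
    rw [vertexCoord_succ_cos_sin, hs] at h1
    rw [vertexCoord_cos_sin, hs] at h2
    have hp := hpos k
    constructor
    · by_contra hc
      nlinarith
    · by_contra hc
      nlinarith
  let H : ℤ → ℂ := fun k => sidePoint n (A k) (s k)
  let E : ℤ → ℂ := fun k => sidePoint n (A (k - 1) + n) (-s (k - 1))
  have hE : ∀ k, E (k + 1) = H k - 2 * normal n (sideOf n hn0 (A k)) := by
    intro k
    simp only [E, H, add_sub_cancel_right, normal_sideOf]
    exact sidePoint_add hn0 _ _
  have hflip : ∀ k, θ + 2 * ((A k + n : ℤ) : ℝ) * halfAngle n = θ + 2 * A k * halfAngle n + π := by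
    intro k; rw [← two_mul_halfAngle hn0]; push_cast; ring
  have hcross : ∀ k, cross θ (E k) = cross θ (H k) := by
    intro k
    obtain ⟨-, -, -, h3⟩ := h (k - 1)
    rw [sub_add_cancel, hs, hs, vertexCoord_cos_sin, vertexCoord_succ_cos_sin] at h3
    simp only [E, H, cross_sidePoint, hflip, cos_add_pi, sin_add_pi]
    apply mul_right_cancel₀ hcos.ne'
    linarith
  have hsupE : ∀ k (b : ℤ), support n b (E k) ≤ 1 ∧ (support n b (E k) = 1 →
      (2 * n : ℤ) ∣ b - (A (k - 1) + n)) := by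
    intro k b
    have hb := hbound (k - 1)
    by_cases hd : (2 * n : ℤ) ∣ b - (A (k - 1) + n)
    · obtain ⟨q, hq⟩ := hd
      rw [show b = A (k - 1) + n + 2 * n * q by linarith, support_add_mul hn0, support_sidePoint]
      simp
    · have := support_lt_of_abs_lt hn (a := A (k - 1) + n) (b := b) (s := -s (k - 1)) (by linarith)
        (by linarith) hd
      exact ⟨this.le, fun e => absurd e this.ne⟩
  have hsupH1 : ∀ k, support n (A k) (H k) = 1 := by
    intro k; rw [support_sidePoint]; simp
  have hsupH : ∀ k (b : ℤ), ¬ (2 * n : ℤ) ∣ b - A k → support n b (H k) < 1 := fun k b hb =>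
    support_lt_of_abs_lt hn (hbound k).1 (hbound k).2 hb
  -- The side of entry differs from the side of exit: the velocity points inwards at the first and
  -- outwards at the second.
  have hdisj : ∀ k (b : ℤ), (2 * n : ℤ) ∣ b - A k → ¬ (2 * n : ℤ) ∣ b - (A (k - 1) + n) := by
    intro k b h1 h2
    obtain ⟨q, hq⟩ := dvd_sub h2 h1
    have e := sin_add_two_mul hn0 θ (A (k - 1) + n) q
    rw [show A (k - 1) + n + 2 * n * q = A k by linarith, hflip, sin_add_pi] at e
    have := hpos k
    have := hpos (k - 1)
    linarith
  have hmove : ∀ k, H k = E k + ((along θ (H k) - along θ (E k) : ℝ) : ℂ) *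
      Complex.exp ((θ : ℂ) * Complex.I) := fun k => eq_add_of_cross_eq (hcross k)
  have htau : ∀ k, 0 < along θ (H k) - along θ (E k) := by
    intro k
    have h1 := hsupH1 k
    rw [hmove, support_move] at h1
    have h2 : support n (A k) (E k) < 1 := lt_of_le_of_ne (hsupE k _).1 fun e =>
      hdisj k (A k) (by simp) ((hsupE k _).2 e)
    have hp := hpos k
    exact pos_of_mul_pos_left (b := sin (θ + 2 * A k * halfAngle n)) (by linarith) hp.le
  -- The gluing lowers the coordinate along the direction by these amounts; adding back their
  -- partial sums turns that coordinate into time.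
  obtain ⟨S, hS0, hS⟩ := exists_int_primitive fun k => 2 * sin (θ + 2 * A k * halfAngle n)
  have htime : ∀ k, S (k + 1) + along θ (E (k + 1)) - (S k + along θ (E k)) =
      along θ (H k) - along θ (E k) := by
    intro k
    simp only [hS, E, H, add_sub_cancel_right, along_sidePoint, hflip, sin_add_pi, cos_add_pi]
    ring
  obtain ⟨ε, hε, hmin⟩ := exists_pos_le_sin hn0 θ
  obtain ⟨C, hC⟩ : ∃ C, ∀ k, |along θ (E k)| ≤ C := by
    refine ⟨1 + sin (halfAngle n) / cos (halfAngle n), fun k => ?_⟩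
    have hb := hbound (k - 1)
    have hs' : |(-s (k - 1))| ≤ sin (halfAngle n) / cos (halfAngle n) := by
      rw [abs_neg, abs_le, neg_le, ← neg_le, ← neg_div, div_le_iff₀ hcos, le_div_iff₀ hcos]
      exact ⟨hb.1.le, hb.2.le⟩
    rw [along_sidePoint]
    refine (abs_add_le _ _).trans (add_le_add (abs_sin_le_one _) ?_)
    rw [abs_mul]
    exact (mul_le_of_le_one_right (abs_nonneg _) (abs_cos_le_one _)).trans hs'
  have hSnonneg : ∀ k : ℤ, 0 ≤ k → ε * k ≤ S k := by
    intro k hk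
    induction k, hk using Int.leInduction with
    | base => simp [hS0]
    | succ k _ ih =>
      have := hmin _ (hpos k)
      have := hpos k
      rw [hS]; push_cast; linarith
  have hSnonpos : ∀ k : ℤ, k ≤ 0 → S k ≤ ε * k := by
    intro k hk
    induction k, hk using Int.leInductionDown with
    | base => simp [hS0]
    | pred k _ ih =>
      have h1 := hmin _ (hpos (k - 1))
      have h2 := hpos (k - 1)
      have h3 := hS (k - 1)
      rw [sub_add_cancel] at h3
      push_cast at *
      linarith
  refine ⟨{ θ := θ
            time := fun k => S k + along θ (E k)
            side := fun k => sideOf n hn0 (A k)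
            entry := E
            time_strictMono := strictMono_int_of_lt_succ fun k => by
              have := htime k; have := htau k; linarith
            time_atTop := ?_
            time_atBot := ?_
            inside := ?_
            hits := ?_
            reenters := ?_ }, ?_⟩
  · refine Filter.tendsto_atTop_mono' _ (f₁ := fun k : ℤ => ε * k + -C) ?_
      (Filter.tendsto_atTop_add_const_right _ _
        ((tendsto_intCast_atTop_atTop (R := ℝ)).const_mul_atTop hε))
    filter_upwards [Filter.eventually_ge_atTop 0] with k hk
    have h1 := hSnonneg k hk
    have h2 := abs_le.1 (hC k)
    linarith
  · refine Filter.tendsto_atBot_mono' _ (f₁ := fun k : ℤ => ε * k + C) ?_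
      (Filter.tendsto_atBot_add_const_right _ _
        ((tendsto_intCast_atBot_iff (R := ℝ).2 Filter.tendsto_id).const_mul_atBot hε))
    filter_upwards [Filter.eventually_le_atBot 0] with k hk
    have h1 := hSnonpos k hk
    have h2 := abs_le.1 (hC k)
    linarith
  · intro k t ht
    rw [mem_interiorPolygon_iff hn0]
    intro b
    have ht1 := ht.1
    have ht2 := ht.2
    have e := htime k
    have hH : support n b (H k) = support n b (E k) +
        (along θ (H k) - along θ (E k)) * sin (θ + 2 * b * halfAngle n) := by
      conv_lhs => rw [hmove, support_move]
    rw [support_move]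
    obtain ⟨hE1, hE2⟩ := hsupE k b
    set r := t - (S k + along θ (E k))
    set T := along θ (H k) - along θ (E k)
    have hr : 0 < r := by simp only [r]; linarith
    have hrT : r < T := by simp only [r]; linarith
    have hT : 0 < T := hr.trans hrT
    -- Interior points of the segment are convex combinations of its ends, of which at most one lies
    -- on the line of side `b`.
    have comb : T * (support n b (E k) + r * sin (θ + 2 * b * halfAngle n)) =
        (T - r) * support n b (E k) + r * support n b (H k) := by rw [hH]; ring
    have goal : T * (support n b (E k) + r * sin (θ + 2 * b * halfAngle n)) < T * 1 := by
      rw [comb]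
      by_cases hd : (2 * n : ℤ) ∣ b - A k
      · have h1 : support n b (E k) < 1 := lt_of_le_of_ne hE1 fun e => hdisj k b hd (hE2 e)
        have h2 : support n b (H k) = 1 := by
          obtain ⟨q, hq⟩ := hd
          rw [show b = A k + 2 * n * q by linarith, support_add_mul hn0, hsupH1]
        rw [h2]
        nlinarith
      · have h2 := hsupH k b hd
        nlinarith
    exact lt_of_mul_lt_mul_left goal hT.le
  · intro k
    rw [htime, ← hmove, mem_openSide_iff hn0, support_sideOf hn0]
    refine ⟨hsupH1 k, fun b hb => hsupH k b fun hd => hb ?_⟩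
    have := sideOf_add hn0 (A k)
    obtain ⟨q, hq⟩ := hd
    exact ⟨q + A k / (2 * n), by linarith⟩
  · intro k
    rw [htime, ← hmove]
    exact hE k
  · ext k
    simp only [cuttingSequence, label]
    rw [← (h k).1]
    conv_rhs => rw [← sideOf_add hn0 (A k)]
    push_cast
    simp

/-- The `2n` sectors cover the angles in `[0, π]`. An opposite direction codes the same words, since
negating `X` amounts to renumbering each side as its opposite side, with the same letter. -/
theorem cuttingSequences_eq (hn : 1 < n) :
    cuttingSequences n = ⋃ i ∈ Set.Iio (2 * n), sectorWords n i := by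
  have hn0 : 0 < n := by omega
  ext w
  rw [Set.mem_iUnion₂]
  constructor
  · rintro ⟨τ, rfl⟩
    have main : ∀ u v : ℝ, 0 ≤ v → IsCoded n (vertexCoord n u v) (cuttingSequence τ) →
        ∃ i, ∃ _ : i ∈ Set.Iio (2 * n), cuttingSequence τ ∈ sectorWords n i := by
      intro u v hv h
      have e := wedge_antiperiodic hn0 u v 0
      rw [zero_add, wedge_zero] at e
      obtain ⟨i, -, hi, h1, h2⟩ := exists_sector (n := n) (u := u) (v := v) (a := 0) (b := 2 * n)
        (by omega) (by rwa [Nat.cast_zero, wedge_zero])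
        (Or.inr ⟨by omega, by push_cast; rw [e]; linarith⟩)
      exact ⟨i, hi, u, v, h1, h2, h⟩
    have h := isCoded_cuttingSequence hn τ
    rcases le_total 0 (sin τ.θ) with hv | hv
    · exact main _ _ hv h
    · refine main (-cos τ.θ) (-sin τ.θ) (by linarith) ?_
      have h' := h.rotate (c := n) (p := 1) fun a => by simp
      rw [relabel_one] at h'
      convert h' using 2 with a
      have := vertexCoord_antiperiodic hn0 (cos τ.θ) (sin τ.θ) (a - n)
      rw [sub_add_cancel] at this
      rw [← neg_eq_iff_eq_neg.2 this]
      simp only [vertexCoord]; ring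
  · rintro ⟨i, -, u, v, -, -, h⟩
    have hne : (⟨u, v⟩ : ℂ) ≠ 0 := by
      intro h0
      have hu : u = 0 := congrArg Complex.re h0
      have hv : v = 0 := congrArg Complex.im h0
      obtain ⟨x, A, h⟩ := h
      obtain ⟨-, h1, h2, -⟩ := h 0
      simp only [vertexCoord, hu, hv, zero_mul, sub_zero] at h1 h2
      linarith
    have hpos := norm_pos_iff.2 hne
    have e1 := Complex.norm_mul_cos_arg (⟨u, v⟩ : ℂ)
    have e2 := Complex.norm_mul_sin_arg (⟨u, v⟩ : ℂ)
    apply mem_cuttingSequences_of_isCoded hn (θ := Complex.arg ⟨u, v⟩)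
    convert h.smul (inv_pos.2 hpos) using 2 with a
    rw [eq_inv_mul_iff_mul_eq₀ hpos.ne', vertexCoord, vertexCoord, mul_sub, ← mul_assoc, ← mul_assoc,
      e1, e2]

end
end TwoNGon

theorem theorem6p3 (n : ℕ) (hn : 3 ≤ n) :
    closure (TwoNGon.cuttingSequences n) = TwoNGon.infinitelyCoherent n ∧
    closure (TwoNGon.cuttingSequences n) =
      ⋂ k : ℕ, ⋃ s ∈ {s : ℕ → ℕ | s 0 < 2 * n ∧ ∀ m, 1 ≤ m → m ≤ k → 1 ≤ s m ∧ s m < 2 * n},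
        TwoNGon.generatedSet n k s := by
  have : NeZero n := ⟨by omega⟩
  rw [TwoNGon.cuttingSequences_eq (by omega)]
  have h1 := TwoNGon.closure_subset_infinitelyCoherent hn
  have h2 := TwoNGon.infinitelyCoherent_subset hn
  have h3 := TwoNGon.generated_subset_closure hn
  exact ⟨h1.antisymm (h2.trans h3), (h1.trans h2).antisymm h3⟩
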